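/- Let $K$ be an arbitrary field, $n\ge 0$, and let $E=K\langle e_1,\dots,e_n\rangle$ be the standard graded exterior algebra over $K$ with $\deg e_i=1$, $\mathfrak m=(e_1,\dots,e_n)$ and $K=E/\mathfrak m$. Order the monomials $e_S=e_{j_1}\wedge\dots\wedge e_{j_t}$, $S=\{j_1<\dots<j_t\}\subseteq\{1,\dots,n\}$, by the (degree) reverse lexicographic order induced by $e_1>\dots>e_n$: $e_S<e_T$ if $|S|<|T|$, or if $|S|=|T|$, $S\ne T$ and the largest index lying in exactly one of $S,T$ lies in $S$. For an ideal $J\subseteq E$ let $\operatorname{in}(J)$ be the ideal generated by the initial (that is, largest) monomials of the nonzero elements of $J$. For a graded $E$-module $M$ let $\mu_{i,j}(M)=\dim_K\operatorname{Ext}^i_E(K,M)_j$ $(i\in\mathbb N,\ j\in\mathbb Z)$ be its graded Bass numbers. If $J\subseteq E$ is a graded ideal, then $$\mu_{i,j}(E/J)\le\mu_{i,j}(E/\operatorname{in}(J))\qquad\text{for all } i\in\mathbb N,\ j\in\mathbb Z.$$ -/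

import Mathlib

universe u

noncomputable section

namespace ExteriorBass

/-- The exterior algebra `E = K⟨e₁, …, eₙ⟩`. -/
abbrev Alg (K : Type u) [Field K] (n : ℕ) : Type u := ExteriorAlgebra K (Fin n → K)

variable {K : Type u} [Field K] {n : ℕ}

/-! ### Monomials, the reverse lexicographic order, initial ideals -/

variable (K) in
/-- The `K`-basis of `E` consisting of the monomials `e_S = e_{j₁} ∧ ⋯ ∧ e_{jₜ}`,
`S = {j₁ < ⋯ < jₜ}`. -/
def monomialBasis (n : ℕ) : Module.Basis (Finset (Fin n)) K (Alg K n) :=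
  (Pi.basisFun K (Fin n)).ExteriorAlgebra

/-- `RevLexLT S T` says that `e_S < e_T` in the (degree) reverse lexicographic order induced by
`e₁ > ⋯ > eₙ`: either `e_S` has smaller degree, or the degrees agree and the largest index at which
`S` and `T` differ belongs to `S`. -/
def RevLexLT (S T : Finset (Fin n)) : Prop :=
  S.card < T.card ∨
    (S.card = T.card ∧ ∃ i, i ∈ S ∧ i ∉ T ∧ ∀ k, i < k → (k ∈ S ↔ k ∈ T))

/-- `e_S` is the initial monomial of `f`: it occurs in `f`, and every other monomial that occurs
in `f` is smaller. -/
def IsInitial (f : Alg K n) (S : Finset (Fin n)) : Prop :=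
  (monomialBasis K n).repr f S ≠ 0 ∧
    ∀ T, (monomialBasis K n).repr f T ≠ 0 → T ≠ S → RevLexLT T S

/-- The initial ideal `in(J)`, generated by the initial monomials of the nonzero elements of `J`. -/
def initialIdeal (J : Ideal (Alg K n)) : Ideal (Alg K n) :=
  Ideal.span {m | ∃ f ∈ J, ∃ S, IsInitial f S ∧ m = monomialBasis K n S}

/-! ### Gradings -/

variable (K n) in
/-- The homogeneous component `E_k`, `k ∈ ℤ`. -/
def grade : ℤ → Submodule K (Alg K n)
  | Int.ofNat m => ⋀[K]^m (Fin n → K)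
  | Int.negSucc _ => ⊥

/-- The homogeneous component `(E/J)_k`, the image of `E_k`. -/
def quotGrade (J : Ideal (Alg K n)) (k : ℤ) : Submodule K (Alg K n ⧸ J) :=
  (grade K n k).map (J.mkQ.restrictScalars K)

/-- The component of degree `k` of the graded free module `⨁ₐ E(-deg a)` whose basis element
with index `a` has degree `deg a`. -/
def freeGrade {ι : Type u} (deg : ι → ℤ) (k : ℤ) : Submodule K (ι →₀ Alg K n) where
  carrier := {x | ∀ a, x a ∈ grade K n (k - deg a)}
  add_mem' hx hy a := add_mem (hx a) (hy a)
  zero_mem' _ := zero_mem _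
  smul_mem' c _ hx a := Submodule.smul_mem _ c (hx a)

variable (K n) in
/-- The graded maximal ideal `𝔪 = (e₁, …, eₙ)`. The residue field is `K = E/𝔪`, concentrated
in degree `0`. -/
def maxIdeal : Ideal (Alg K n) :=
  Ideal.span (Set.range fun i : Fin n => ExteriorAlgebra.ι K (Pi.single i (1 : K)))

/-! ### Graded free resolutions of the residue field, and graded `Ext` -/

variable (K n) in
/-- A graded free resolution `⋯ → F₁ → F₀ → K → 0` of the residue field `K = E/𝔪` over `E`:
`Fᵢ` is the graded free module `⨁ₐ E(-deg i a)`, all maps are `E`-linear and homogeneous of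
degree `0`, and the sequence is exact. -/
structure GradedFreeResolution where
  /-- index set of the basis of `Fᵢ` -/
  ι : ℕ → Type u
  /-- degrees of the basis elements of `Fᵢ` -/
  deg : ∀ i, ι i → ℤ
  /-- the differential `Fᵢ₊₁ → Fᵢ` -/
  d : ∀ i, (ι (i + 1) →₀ Alg K n) →ₗ[Alg K n] (ι i →₀ Alg K n)
  /-- the augmentation `F₀ → K` -/
  ε : (ι 0 →₀ Alg K n) →ₗ[Alg K n] (Alg K n ⧸ maxIdeal K n)
  d_homogeneous : ∀ i k x, x ∈ freeGrade (deg (i + 1)) k → d i x ∈ freeGrade (deg i) k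
  ε_homogeneous : ∀ k x, x ∈ freeGrade (deg 0) k → ε x ∈ quotGrade (maxIdeal K n) k
  ε_surjective : Function.Surjective ε
  exact_zero : Function.Exact (d 0) ε
  exact_succ : ∀ i, Function.Exact (d (i + 1)) (d i)

/-! ### Existence of graded free resolutions -/

lemma mul_mem_grade {k l : ℤ} {a b : Alg K n} (ha : a ∈ grade K n k) (hb : b ∈ grade K n l) :
    a * b ∈ grade K n (k + l) := by
  cases k with
  | negSucc p =>
    have : a = 0 := by simpa [grade] using ha
    subst this
    simp
  | ofNat p =>
    cases l with
    | negSucc q =>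
      have : b = 0 := by simpa [grade] using hb
      subst this
      simp
    | ofNat q => exact SetLike.mul_mem_graded (A := fun m : ℕ => ⋀[K]^m (Fin n → K)) ha hb

/-- The projection of `E` onto its component of degree `k`. -/
def gradeProj : ℤ → Alg K n →ₗ[K] Alg K n
  | Int.ofNat m => GradedAlgebra.proj (fun m : ℕ => ⋀[K]^m (Fin n → K)) m
  | Int.negSucc _ => 0

lemma gradeProj_of_mem {k : ℤ} {x : Alg K n} (hx : x ∈ grade K n k) (l : ℤ) :
    gradeProj l x = if l = k then x else 0 := by
  cases k with
  | negSucc p =>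
    have : x = 0 := by simpa [grade] using hx
    simp [this]
  | ofNat p =>
    cases l with
    | negSucc q => simp [gradeProj]
    | ofNat q =>
      have hx' : x ∈ ⋀[K]^p (Fin n → K) := hx
      split_ifs with h
      · cases h
        rw [gradeProj, GradedAlgebra.proj_apply]
        exact DirectSum.decompose_of_mem_same (fun m : ℕ => ⋀[K]^m (Fin n → K)) hx'
      · rw [gradeProj, GradedAlgebra.proj_apply]
        exact DirectSum.decompose_of_mem_ne (fun m : ℕ => ⋀[K]^m (Fin n → K)) hx'
          (fun h' => h (by rw [h']))

/-- Homogeneous elements of distinct degrees in a graded free module are independent. -/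
lemma freeGrade_independent {ι : Type u} (deg : ι → ℤ) (S : Finset ℤ) (y : ℤ → ι →₀ Alg K n)
    (hy : ∀ k, y k ∈ freeGrade deg k) (h : ∑ k ∈ S, y k = 0) (k : ℤ) (hk : k ∈ S) : y k = 0 := by
  ext1 a
  have h1 : ∑ l ∈ S, y l a = 0 := by
    rw [← Finsupp.finsetSum_apply, h]; rfl
  have h2 := congrArg (gradeProj (k - deg a)) h1
  rw [map_sum, map_zero, Finset.sum_eq_single k] at h2
  · rwa [gradeProj_of_mem (hy k a), if_pos rfl] at h2
  · intro l _ hl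
    rw [gradeProj_of_mem (hy l a), if_neg]
    omega
  · exact fun h => absurd hk h

lemma smul_mem_freeGrade {ι : Type u} (deg : ι → ℤ) {k l : ℤ} {e : Alg K n} {x : ι →₀ Alg K n}
    (he : e ∈ grade K n k) (hx : x ∈ freeGrade deg l) : e • x ∈ freeGrade deg (k + l) := by
  intro a
  have := mul_mem_grade he (hx a)
  rwa [show k + (l - deg a) = k + l - deg a by ring] at this

lemma iSup_freeGrade {ι : Type u} (deg : ι → ℤ) :
    ⨆ k, (freeGrade deg k : Submodule K (ι →₀ Alg K n)) = ⊤ := by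
  rw [eq_top_iff]
  rintro x -
  induction x using Finsupp.induction_linear with
  | zero => exact zero_mem _
  | add x y hx hy => exact add_mem hx hy
  | single a e =>
    induction e using DirectSum.Decomposition.inductionOn (fun m : ℕ => ⋀[K]^m (Fin n → K)) with
    | zero => simp
    | add x y hx hy => rw [Finsupp.single_add]; exact add_mem hx hy
    | homogeneous e =>
      rename_i m
      refine Submodule.mem_iSup_of_mem (deg a + m) fun b => ?_
      by_cases hb : a = b
      · subst hb
        rw [Finsupp.single_eq_same, show deg a + (m : ℤ) - deg a = (m : ℤ) by ring]
        exact e.2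
      · rw [Finsupp.single_eq_of_ne' hb]
        exact zero_mem _

/-- A submodule of a graded free module is graded if it is generated by homogeneous elements. -/
def IsGradedSub {ι : Type u} (deg : ι → ℤ) (Z : Submodule (Alg K n) (ι →₀ Alg K n)) : Prop :=
  Z ≤ Submodule.span (Alg K n) {x | x ∈ Z ∧ ∃ k, x ∈ freeGrade (K := K) deg k}

lemma isGradedSub_ker {ι κ : Type u} (deg : ι → ℤ) (deg' : κ → ℤ)
    (d : (ι →₀ Alg K n) →ₗ[Alg K n] (κ →₀ Alg K n))
    (hd : ∀ k x, x ∈ freeGrade deg k → d x ∈ freeGrade deg' k) :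
    IsGradedSub deg (LinearMap.ker d) := by
  intro x hx
  have hx' : x ∈ ⨆ k, (freeGrade deg k : Submodule K (ι →₀ Alg K n)) := by
    rw [iSup_freeGrade]; trivial
  rw [Submodule.mem_iSup_iff_exists_finsupp] at hx'
  obtain ⟨y, hy, rfl⟩ := hx'
  rw [LinearMap.mem_ker, Finsupp.sum, map_sum] at hx
  refine Submodule.sum_mem _ fun k hk => Submodule.subset_span ⟨?_, k, hy k⟩
  exact freeGrade_independent deg' y.support (fun k => d (y k)) (fun k => hd k _ (hy k)) hx k hk

/-- The index set of the tautological free cover of a graded submodule. -/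
abbrev CoverIdx {ι : Type u} (deg : ι → ℤ) (Z : Submodule (Alg K n) (ι →₀ Alg K n)) : Type u :=
  {p : (ι →₀ Alg K n) × ℤ // p.1 ∈ Z ∧ p.1 ∈ freeGrade (K := K) deg p.2}

/-- The tautological free cover of a graded submodule. -/
def cover {ι : Type u} (deg : ι → ℤ) (Z : Submodule (Alg K n) (ι →₀ Alg K n)) :
    (CoverIdx deg Z →₀ Alg K n) →ₗ[Alg K n] (ι →₀ Alg K n) :=
  Finsupp.linearCombination (Alg K n) fun p : CoverIdx deg Z => p.1.1

lemma cover_homogeneous {ι : Type u} (deg : ι → ℤ) (Z : Submodule (Alg K n) (ι →₀ Alg K n))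
    (k : ℤ) (x : CoverIdx deg Z →₀ Alg K n)
    (hx : x ∈ freeGrade (fun p : CoverIdx deg Z => p.1.2) k) :
    cover deg Z x ∈ freeGrade deg k := by
  rw [cover, Finsupp.linearCombination_apply, Finsupp.sum]
  refine Submodule.sum_mem _ fun p _ => ?_
  have := smul_mem_freeGrade deg (hx p) p.2.2
  rwa [sub_add_cancel] at this

lemma range_cover {ι : Type u} (deg : ι → ℤ) (Z : Submodule (Alg K n) (ι →₀ Alg K n))
    (hZ : IsGradedSub deg Z) : LinearMap.range (cover deg Z) = Z := by
  rw [cover, Finsupp.range_linearCombination]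
  refine le_antisymm (Submodule.span_le.2 ?_) (hZ.trans (Submodule.span_mono ?_))
  · rintro _ ⟨p, rfl⟩
    exact p.2.1
  · rintro x ⟨hx, k, hk⟩
    exact ⟨⟨(x, k), hx, hk⟩, rfl⟩

variable (K n) in
/-- A graded submodule of a graded free module. -/
structure Stage where
  ι : Type u
  deg : ι → ℤ
  Z : Submodule (Alg K n) (ι →₀ Alg K n)
  graded : IsGradedSub deg Z

/-- The kernel of the tautological free cover. -/
def Stage.next (s : Stage K n) : Stage K n where
  ι := CoverIdx s.deg s.Z
  deg p := p.1.2
  Z := LinearMap.ker (cover s.deg s.Z)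
  graded := isGradedSub_ker _ _ _ (cover_homogeneous s.deg s.Z)

/-- The augmentation `E → E/𝔪`. -/
def augmentation : (PUnit.{u + 1} →₀ Alg K n) →ₗ[Alg K n] (Alg K n ⧸ maxIdeal K n) :=
  (maxIdeal K n).mkQ ∘ₗ Finsupp.lapply PUnit.unit

lemma augmentation_surjective : Function.Surjective (augmentation (K := K) (n := n)) := by
  intro y
  obtain ⟨e, rfl⟩ := (maxIdeal K n).mkQ_surjective y
  refine ⟨Finsupp.single PUnit.unit e, ?_⟩
  rw [augmentation, LinearMap.comp_apply, Finsupp.lapply_apply, Finsupp.single_eq_same]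

/-- The kernel of the augmentation. -/
def Stage.init : Stage K n where
  ι := PUnit
  deg _ := 0
  Z := LinearMap.ker augmentation
  graded := by
    intro x hx
    have hx' : x PUnit.unit ∈ maxIdeal K n := by
      simpa [augmentation] using hx
    have hxs : x = Finsupp.lsingle (R := Alg K n) PUnit.unit (x PUnit.unit) := by
      ext
      simp
    rw [hxs]
    rw [← Submodule.mem_comap]
    refine Submodule.span_le.2 ?_ hx'
    rintro _ ⟨i, rfl⟩
    refine Submodule.subset_span ⟨?_, 1, fun a => ?_⟩
    · simp only [augmentation, LinearMap.mem_ker, LinearMap.comp_apply, Finsupp.lapply_apply,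
        Finsupp.lsingle_apply, Finsupp.single_eq_same, Submodule.mkQ_apply,
        Submodule.Quotient.mk_eq_zero]
      exact Ideal.subset_span ⟨i, rfl⟩
    · simp only [Finsupp.lsingle_apply, Finsupp.single_eq_same]
      change _ ∈ ⋀[K]^1 (Fin n → K)
      rw [ExteriorAlgebra.exteriorPower, pow_one]
      exact ⟨_, rfl⟩

variable (K n) in
/-- The iterated tautological covers. -/
def stage : ℕ → Stage K n
  | 0 => Stage.init
  | i + 1 => (stage i).next

lemma Stage.exact (s : Stage K n) :
    Function.Exact (cover s.next.deg s.next.Z) (cover s.deg s.Z) :=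
  LinearMap.exact_iff.2 (range_cover s.next.deg s.next.Z s.next.graded).symm

lemma Stage.exact_init :
    Function.Exact (cover (Stage.init : Stage K n).deg (Stage.init : Stage K n).Z)
      (augmentation (K := K) (n := n)) :=
  LinearMap.exact_iff.2 (range_cover (Stage.init : Stage K n).deg _ Stage.init.graded).symm

instance : Nonempty (GradedFreeResolution K n) :=
  ⟨{ ι := fun i => (stage K n i).ι
     deg := fun i => (stage K n i).deg
     d := fun i => cover (stage K n i).deg (stage K n i).Z
     ε := augmentation
     d_homogeneous := fun i => cover_homogeneous (stage K n i).deg (stage K n i).Z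
     ε_homogeneous := fun k x hx => ⟨x PUnit.unit, by
       have := hx PUnit.unit
       rwa [show k - (stage K n 0).deg PUnit.unit = k from sub_zero k] at this, rfl⟩
     ε_surjective := augmentation_surjective
     exact_zero := Stage.exact_init
     exact_succ := fun i => (stage K n i).exact }⟩

namespace GradedFreeResolution

variable (P : GradedFreeResolution K n)
variable {M : Type u} [AddCommGroup M] [Module K M] [Module (Alg K n) M]
  [IsScalarTower K (Alg K n) M] (ℳ : ℤ → Submodule K M)

/-- `Hom_E(Fᵢ, M)_j`: the `E`-linear maps `Fᵢ → M` that are homogeneous of degree `j`, for a graded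
`E`-module `M` with homogeneous components `ℳ k`. -/
def homDegree (i : ℕ) (j : ℤ) : Submodule K ((P.ι i →₀ Alg K n) →ₗ[Alg K n] M) where
  carrier := {f | ∀ k x, x ∈ freeGrade (P.deg i) k → f x ∈ ℳ (k + j)}
  add_mem' hf hg k x hx := add_mem (hf k x hx) (hg k x hx)
  zero_mem' _ _ _ := zero_mem _
  smul_mem' c _ hf k x hx := Submodule.smul_mem _ c (hf k x hx)

variable (M) in
/-- The map `Hom_E(Fᵢ, M) → Hom_E(Fᵢ₊₁, M)`, `f ↦ f ∘ d`. -/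
def coboundary (i : ℕ) :
    ((P.ι i →₀ Alg K n) →ₗ[Alg K n] M) →ₗ[K] ((P.ι (i + 1) →₀ Alg K n) →ₗ[Alg K n] M) where
  toFun f := f ∘ₗ P.d i
  map_add' _ _ := rfl
  map_smul' _ _ := rfl

/-- The cocycles in `Hom_E(Fᵢ, M)_j`. -/
def cocycles (i : ℕ) (j : ℤ) : Submodule K ((P.ι i →₀ Alg K n) →ₗ[Alg K n] M) :=
  P.homDegree ℳ i j ⊓ LinearMap.ker (P.coboundary M i)

/-- The coboundaries in `Hom_E(Fᵢ, M)_j`. -/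
def coboundaries : (i : ℕ) → (j : ℤ) → Submodule K ((P.ι i →₀ Alg K n) →ₗ[Alg K n] M)
  | 0, _ => ⊥
  | i + 1, j => (P.homDegree ℳ i j).map (P.coboundary M i)

/-- `Ext^i_E(K, M)_j`, the `i`-th cohomology of the complex `Hom_E(F, M)_j`. -/
abbrev ext (i : ℕ) (j : ℤ) : Type u :=
  P.cocycles ℳ i j ⧸ (P.coboundaries ℳ i j).submoduleOf (P.cocycles ℳ i j)

/-- The graded Bass number `μ_{i,j}(M) = dim_K Ext^i_E(K, M)_j`, computed from the graded free
resolution `P` of `K` (up to isomorphism, `Ext` does not depend on `P`). -/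
def bassNumber (i : ℕ) (j : ℤ) : Cardinal.{u} := Module.rank K (P.ext ℳ i j)

end GradedFreeResolution

end ExteriorBass

end

/-!
Bass numbers can only grow when a graded ideal `J` of the exterior algebra `E` is replaced by its
initial ideal.

The reverse lexicographic order on monomials of a fixed degree is given by an additive integral
weight, `e_i` having weight `-2^i` (`revLexLT_iff`, `weight_revWeight_lt_iff`). Additivity makes the
set of initial monomials of homogeneous elements of `J` closed under nonzero multiplication, so that
`in(J)` is their `K`-span (`mem_initialIdeal_iff`). The residue field has a resolution `F` by graded
free modules of finite rank whose differentials preserve both degree and weight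
(`exists_weighted_resolution`): kernels of bihomogeneous maps are generated by bihomogeneous
elements, and `E` is Noetherian. Graded chain maps and homotopies show that Bass numbers may be
computed from `F` instead of any given resolution (`bassNumber_le_of_resolutions`).

For such an `F`, fix the internal degree `j`, let `V^i` be the space of maps `F_i → E` of degree `j`,
`B^i` the image of `V^{i-1}` in `V^i` and `W^i(J)` the maps in `V^i` with values in `J`. Then
`Hom(F, E/J)` is `V/W(J)`, and counting dimensions gives (`finrank_ext_quotGrade_add`)

  `dim Ext^i + dim (B^i + W^i(J)) + dim (B^{i+1} + W^{i+1}(J)) = dim V^i + dim W^{i+1}(J)`.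

The spaces `V^i` are graded by weight, and `B^i` and `W^i(in(J))` are homogeneous subspaces. Each
homogeneous element of `B^i + W^i(in(J))` is the leading component of an element of `B^i + W^i(J)`,
whence `dim (B^i + W^i(in(J))) ≤ dim (B^i + W^i(J))` (`finrank_coboundaries_sup_le`). On the other
hand `dim W^i(J) ≤ dim W^i(in(J))`, because an element of `J` is determined by its coordinates at
the initial monomials (`finrank_homIdeal_le`). The inequality of Bass numbers follows.
-/

noncomputable section

namespace ExteriorBass

open Module

variable {K : Type u} [Field K] {n : ℕ}

/-! ### Products and coordinate projections in the monomial basis -/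

lemma monomialBasis_mul_of_not_disjoint {S T : Finset (Fin n)} (h : ¬Disjoint S T) :
    monomialBasis K n S * monomialBasis K n T = 0 :=
  ExteriorAlgebra.basis_mul_of_not_disjoint (Pi.basisFun K (Fin n))
    (⟨S, rfl⟩ : Set.powersetCard (Fin n) S.card) ⟨T, rfl⟩ h

lemma monomialBasis_mul_of_disjoint {S T : Finset (Fin n)} (h : Disjoint S T) :
    ∃ c : K, c ≠ 0 ∧
      monomialBasis K n S * monomialBasis K n T = c • monomialBasis K n (S ∪ T) := by
  have key := ExteriorAlgebra.basis_mul_of_disjoint (Pi.basisFun K (Fin n))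
    (⟨S, rfl⟩ : Set.powersetCard (Fin n) S.card) (⟨T, rfl⟩ : Set.powersetCard (Fin n) T.card) h
  rw [Set.powersetCard.coe_disjUnion, Finset.disjUnion_eq_union] at key
  obtain hs | hs := Int.units_eq_one_or (Set.powersetCard.permOfDisjoint
    (s := (⟨S, rfl⟩ : Set.powersetCard (Fin n) S.card))
    (t := (⟨T, rfl⟩ : Set.powersetCard (Fin n) T.card)) h).sign
  · rw [hs, one_smul] at key
    exact ⟨1, one_ne_zero, by rw [one_smul]; exact key⟩
  · rw [hs, Units.neg_smul, one_smul] at key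
    exact ⟨-1, neg_ne_zero.2 one_ne_zero, by rw [neg_one_smul]; exact key⟩

/-- The monomials of a product are products of monomials of the factors. -/
lemma exists_of_repr_mul_ne_zero {x y : Alg K n} {U : Finset (Fin n)}
    (h : (monomialBasis K n).repr (x * y) U ≠ 0) :
    ∃ S T, Disjoint S T ∧ S ∪ T = U ∧ (monomialBasis K n).repr x S ≠ 0 ∧
      (monomialBasis K n).repr y T ≠ 0 := by
  by_contra! hc
  apply h
  rw [← (monomialBasis K n).sum_repr x, ← (monomialBasis K n).sum_repr y, Finset.sum_mul_sum,
    map_sum, Finsupp.finsetSum_apply]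
  refine Finset.sum_eq_zero fun S _ => ?_
  rw [map_sum, Finsupp.finsetSum_apply]
  refine Finset.sum_eq_zero fun T _ => ?_
  rw [smul_mul_smul_comm, map_smul, Finsupp.smul_apply, smul_eq_mul]
  by_cases hST : Disjoint S T
  · obtain ⟨c, -, hc'⟩ := monomialBasis_mul_of_disjoint (K := K) hST
    rw [hc', map_smul, Basis.repr_self, Finsupp.smul_apply]
    by_cases hU : S ∪ T = U
    · by_cases hx : (monomialBasis K n).repr x S = 0
      · simp [hx]
      · simp [hc S T hST hU hx]
    · simp [Finsupp.single_eq_of_ne' hU]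
  · simp [monomialBasis_mul_of_not_disjoint hST]

open Classical in
/-- The coordinate projection of `E` onto the span of the monomials `e_S` with `S ∈ p`. -/
def restr (p : Set (Finset (Fin n))) : Alg K n →ₗ[K] Alg K n :=
  (monomialBasis K n).constr K fun S => if S ∈ p then monomialBasis K n S else 0

open Classical in
lemma repr_restr (p : Set (Finset (Fin n))) (x : Alg K n) (S : Finset (Fin n)) :
    (monomialBasis K n).repr (restr p x) S =
      if S ∈ p then (monomialBasis K n).repr x S else 0 := by
  rw [restr, Basis.constr_apply_fintype, map_sum, Finsupp.finsetSum_apply, Finset.sum_eq_single S]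
  · by_cases h : S ∈ p <;> simp [h]
  · intro T _ hT
    by_cases h : T ∈ p <;> simp [h, hT]
  · simp

lemma repr_restr_of_mem {p : Set (Finset (Fin n))} {S : Finset (Fin n)} (h : S ∈ p)
    (x : Alg K n) :
    (monomialBasis K n).repr (restr p x) S = (monomialBasis K n).repr x S := by
  classical rw [repr_restr, if_pos h]

lemma repr_restr_of_notMem {p : Set (Finset (Fin n))} {S : Finset (Fin n)} (h : S ∉ p)
    (x : Alg K n) : (monomialBasis K n).repr (restr p x) S = 0 := by
  classical rw [repr_restr, if_neg h]

lemma ext_repr {x y : Alg K n}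
    (h : ∀ S, (monomialBasis K n).repr x S = (monomialBasis K n).repr y S) : x = y :=
  (monomialBasis K n).repr.injective (Finsupp.ext h)

variable (K) in
/-- The span of the monomials `e_S` with `S ∈ p`, described by the vanishing of the other
coordinates. -/
def monomialSpan (p : Set (Finset (Fin n))) : Submodule K (Alg K n) where
  carrier := {x | ∀ S, (monomialBasis K n).repr x S ≠ 0 → S ∈ p}
  add_mem' {x y} hx hy S hS := by
    by_cases h : (monomialBasis K n).repr x S = 0
    · refine hy S fun h' => hS ?_
      rw [map_add, Finsupp.add_apply, h, h', add_zero]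
    · exact hx S h
  zero_mem' S hS := absurd (by simp) hS
  smul_mem' c x hx S hS := hx S fun h => hS (by simp [h])

lemma monomialBasis_mem_monomialSpan {p : Set (Finset (Fin n))} {S : Finset (Fin n)}
    (h : S ∈ p) : monomialBasis K n S ∈ monomialSpan K p := by
  intro T hT
  rw [Basis.repr_self, Finsupp.single_apply_ne_zero] at hT
  rwa [hT.1]

lemma monomialSpan_le {p : Set (Finset (Fin n))} {W : Submodule K (Alg K n)}
    (h : ∀ S ∈ p, monomialBasis K n S ∈ W) : monomialSpan K p ≤ W := by
  intro x hx
  rw [← (monomialBasis K n).sum_repr x]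
  refine Submodule.sum_mem _ fun S _ => ?_
  by_cases hS : (monomialBasis K n).repr x S = 0
  · simp [hS]
  · exact Submodule.smul_mem _ _ (h S (hx S hS))

lemma restr_mem (p : Set (Finset (Fin n))) (x : Alg K n) : restr p x ∈ monomialSpan K p := by
  intro S hS
  by_contra h
  exact hS (repr_restr_of_notMem h x)

lemma restr_mem_monomialSpan (p : Set (Finset (Fin n))) {q : Set (Finset (Fin n))} {x : Alg K n}
    (hx : x ∈ monomialSpan K q) : restr p x ∈ monomialSpan K q := by
  intro S hS
  by_cases h : S ∈ p
  · exact hx S (by rwa [repr_restr_of_mem h] at hS)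
  · exact absurd (repr_restr_of_notMem h x) hS

lemma restr_of_mem {p : Set (Finset (Fin n))} {x : Alg K n} (hx : x ∈ monomialSpan K p) :
    restr p x = x := by
  refine ext_repr fun S => ?_
  by_cases h : S ∈ p
  · exact repr_restr_of_mem h x
  · rw [repr_restr_of_notMem h]
    by_contra h'
    exact h (hx S (Ne.symm h'))

lemma restr_eq_zero {p q : Set (Finset (Fin n))} (hpq : Disjoint p q) {x : Alg K n}
    (hx : x ∈ monomialSpan K q) : restr p x = 0 := by
  refine ext_repr fun S => ?_
  rw [map_zero, Finsupp.zero_apply]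
  by_cases h : S ∈ p
  · rw [repr_restr_of_mem h]
    by_contra h'
    exact Set.disjoint_left.1 hpq h (hx S h')
  · exact repr_restr_of_notMem h x

/-! ### Gradings of the exterior algebra by weights of the variables -/

section Weights

variable {G H : Type} [AddCommGroup G] [AddCommGroup H]

/-- The weight of the monomial `e_S` when `e_i` has weight `v i`. -/
def weight (v : Fin n → G) (S : Finset (Fin n)) : G := ∑ i ∈ S, v i

lemma weight_union (v : Fin n → G) {S T : Finset (Fin n)} (h : Disjoint S T) :
    weight v (S ∪ T) = weight v S + weight v T :=
  Finset.sum_union h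

variable (K) in
/-- The component of weight `g` of `E`, where `e_i` has weight `v i`. -/
def weightComp (v : Fin n → G) (g : G) : Submodule K (Alg K n) :=
  monomialSpan K {S | weight v S = g}

lemma mul_mem_weightComp {v : Fin n → G} {g h : G} {x y : Alg K n}
    (hx : x ∈ weightComp K v g) (hy : y ∈ weightComp K v h) : x * y ∈ weightComp K v (g + h) := by
  intro U hU
  obtain ⟨S, T, hST, rfl, hS, hT⟩ := exists_of_repr_mul_ne_zero hU
  exact (weight_union v hST).trans (congrArg₂ _ (hx S hS) (hy T hT))

lemma weightComp_le_map (f : G →+ H) (v : Fin n → G) (g : G) :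
    weightComp K v g ≤ weightComp K (fun i => f (v i)) (f g) := by
  intro x hx S hS
  have := congrArg f (hx S hS)
  rwa [weight, map_sum] at this

/-- Multiplication by a homogeneous element commutes with taking components, up to a shift. -/
lemma restr_mul_of_mem {v : Fin n → G} {g : G} {c : Alg K n} (hc : c ∈ weightComp K v g)
    (h : G) (y : Alg K n) :
    restr {S | weight v S = g + h} (c * y) = c * restr {S | weight v S = h} y := by
  have h1 : c * restr {S | weight v S = h} y ∈ weightComp K v (g + h) :=
    mul_mem_weightComp hc (restr_mem _ y)
  have h2 : y - restr {S | weight v S = h} y ∈ monomialSpan K {S | weight v S ≠ h} := by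
    intro S hS hS'
    apply hS
    rw [map_sub, Finsupp.sub_apply, repr_restr_of_mem (p := {S | weight v S = h}) hS', sub_self]
  have h3 : c * (y - restr {S | weight v S = h} y) ∈
      monomialSpan K {S | weight v S ≠ g + h} := by
    intro U hU hU'
    obtain ⟨S, T, hST, rfl, hS, hT⟩ := exists_of_repr_mul_ne_zero hU
    refine h2 T hT (add_left_cancel (a := g) ?_)
    rw [← hU', weight_union v hST, hc S hS]
  have h4 : c * y = c * restr {S | weight v S = h} y +
      c * (y - restr {S | weight v S = h} y) := by
    rw [← mul_add, add_sub_cancel]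
  have h5 : Disjoint {S | weight v S = g + h} {S | weight v S ≠ g + h} :=
    Set.disjoint_left.2 fun S hS hS' => hS' hS
  rw [h4, map_add, restr_of_mem h1, restr_eq_zero h5 h3, add_zero]

end Weights

lemma weight_one (S : Finset (Fin n)) : weight (fun _ => (1 : ℤ)) S = S.card := by
  simp [weight]

lemma monomialBasis_mem_grade (S : Finset (Fin n)) :
    monomialBasis K n S ∈ grade K n S.card := by
  have := ExteriorAlgebra.basis_eq_coe_basis (Pi.basisFun K (Fin n))
    (⟨S, rfl⟩ : Set.powersetCard (Fin n) S.card)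
  change _ ∈ ⋀[K]^S.card (Fin n → K)
  rw [show monomialBasis K n S = _ from this]
  exact Subtype.mem _

lemma gradeProj_eq_restr (k : ℤ) (x : Alg K n) :
    gradeProj k x = restr {S | weight (fun _ => (1 : ℤ)) S = k} x := by
  refine LinearMap.congr_fun ((monomialBasis K n).ext fun S => ?_) x
  rw [gradeProj_of_mem (monomialBasis_mem_grade S)]
  split_ifs with h
  · refine (restr_of_mem (monomialBasis_mem_monomialSpan ?_)).symm
    rw [Set.mem_ofPred_eq, weight_one, h]
  · refine (restr_eq_zero (q := {S}) ?_
      (monomialBasis_mem_monomialSpan (Set.mem_singleton S))).symm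
    rw [Set.disjoint_singleton_right, Set.mem_ofPred_eq, weight_one]
    exact fun h' => h h'.symm

/-- The grading by degree is the one that gives every variable weight `1`. -/
lemma grade_eq_weightComp (k : ℤ) : grade K n k = weightComp K (fun _ => (1 : ℤ)) k := by
  refine le_antisymm (fun x hx => ?_) (monomialSpan_le fun S hS => ?_)
  · have h := gradeProj_of_mem hx k
    rw [if_pos rfl, gradeProj_eq_restr] at h
    rw [← h]
    exact restr_mem _ _
  · rw [Set.mem_ofPred_eq, weight_one] at hS
    rw [← hS]
    exact monomialBasis_mem_grade S

lemma mem_grade_iff {k : ℤ} {x : Alg K n} :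
    x ∈ grade K n k ↔ ∀ S, (monomialBasis K n).repr x S ≠ 0 → (S.card : ℤ) = k := by
  rw [grade_eq_weightComp]
  exact forall₂_congr fun S _ => by rw [Set.mem_ofPred_eq, weight_one]

lemma gradeProj_mem_of_isHomogeneous {J : Ideal (Alg K n)}
    (hJ : J.IsHomogeneous (fun m : ℕ => ⋀[K]^m (Fin n → K))) {x : Alg K n} (hx : x ∈ J) (k : ℤ) :
    gradeProj k x ∈ J := by
  cases k with
  | negSucc p => exact zero_mem _
  | ofNat m =>
    rw [gradeProj, GradedAlgebra.proj_apply]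
    exact hJ m hx

/-! ### The reverse lexicographic weight and initial ideals -/

/-- The weights `-2^i` of the variables: on monomials of the same degree they induce the reverse
lexicographic order. -/
def revWeight (i : Fin n) : ℤ := -2 ^ (i : ℕ)

lemma weight_revWeight (S : Finset (Fin n)) :
    weight revWeight S = -((∑ k ∈ S.map Fin.valEmbedding, 2 ^ k : ℕ) : ℤ) := by
  simp [weight, revWeight, Finset.sum_map]

lemma weight_revWeight_injective :
    Function.Injective (weight (revWeight : Fin n → ℤ)) := by
  intro S T h
  rw [weight_revWeight, weight_revWeight, neg_inj, Nat.cast_inj] at h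
  exact Finset.map_injective _ (Finset.geomSum_injective le_rfl h)

lemma weight_revWeight_lt_iff {S T : Finset (Fin n)} :
    weight revWeight S < weight revWeight T ↔
      ∃ i, i ∈ S ∧ i ∉ T ∧ ∀ k, i < k → (k ∈ S ↔ k ∈ T) := by
  rw [weight_revWeight, weight_revWeight, neg_lt_neg_iff, Nat.cast_lt,
    Finset.geomSum_lt_geomSum_iff_toColex_lt_toColex le_rfl, Finset.map_eq_image,
    Finset.map_eq_image]
  erw [
    Finset.Colex.toColex_image_lt_toColex_image Fin.val_strictMono,
    Finset.Colex.lt_iff_exists_filter_lt]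
  refine exists_congr fun i => ?_
  simp only [Finset.mem_sdiff, and_assoc, Finset.ext_iff, Finset.mem_filter]
  refine and_congr_right fun _ => and_congr_right fun _ => forall_congr' fun k => ?_
  tauto

lemma revLexLT_iff {S T : Finset (Fin n)} :
    RevLexLT S T ↔ S.card < T.card ∨
      (S.card = T.card ∧ weight revWeight S < weight revWeight T) := by
  rw [weight_revWeight_lt_iff, RevLexLT]

lemma exists_isInitial {f : Alg K n} (hf : f ≠ 0) : ∃ S, IsInitial f S := by
  have hne : ((monomialBasis K n).repr f).support.Nonempty := by
    rw [Finsupp.support_nonempty_iff]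
    exact (LinearEquiv.map_ne_zero_iff _).2 hf
  obtain ⟨S, hS, hmax⟩ := Finset.exists_max_image _
    (fun S : Finset (Fin n) => toLex (S.card, weight revWeight S)) hne
  refine ⟨S, Finsupp.mem_support_iff.1 hS, fun T hT hTS => ?_⟩
  have h := hmax T (Finsupp.mem_support_iff.2 hT)
  have hw : weight revWeight T ≠ weight revWeight S := fun h' =>
    hTS (weight_revWeight_injective h')
  rw [revLexLT_iff]
  rw [Prod.Lex.toLex_le_toLex] at h
  exact h.imp_right fun h' => ⟨h'.1, lt_of_le_of_ne h'.2 hw⟩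

/-- The exponent sets of the initial monomials of the homogeneous elements of `J`; the order is
expressed by the reverse lexicographic weight. -/
def leadSet (J : Ideal (Alg K n)) : Set (Finset (Fin n)) :=
  {S | ∃ f ∈ J, f ∈ grade K n S.card ∧ (monomialBasis K n).repr f S ≠ 0 ∧
    ∀ T, (monomialBasis K n).repr f T ≠ 0 → T ≠ S → weight revWeight T < weight revWeight S}

lemma IsInitial.mem_leadSet {J : Ideal (Alg K n)}
    (hJ : J.IsHomogeneous (fun m : ℕ => ⋀[K]^m (Fin n → K))) {f : Alg K n} (hf : f ∈ J)
    {S : Finset (Fin n)} (h : IsInitial f S) : S ∈ leadSet J := by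
  refine ⟨gradeProj S.card f, gradeProj_mem_of_isHomogeneous hJ hf _, ?_, ?_, fun T hT hTS => ?_⟩
  · rw [gradeProj_eq_restr, grade_eq_weightComp]
    exact restr_mem _ _
  · rw [gradeProj_eq_restr, repr_restr_of_mem (by simp [weight_one])]
    exact h.1
  · have hc : T ∈ {S' | weight (fun _ : Fin n => (1 : ℤ)) S' = S.card} := by
      rw [gradeProj_eq_restr] at hT
      exact restr_mem _ _ T hT
    rw [gradeProj_eq_restr, repr_restr_of_mem hc] at hT
    rw [Set.mem_ofPred_eq, weight_one, Nat.cast_inj] at hc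
    have := revLexLT_iff.1 (h.2 T hT hTS)
    simpa [hc] using this

lemma monomialBasis_mem_initialIdeal {J : Ideal (Alg K n)} {S : Finset (Fin n)}
    (hS : S ∈ leadSet J) : monomialBasis K n S ∈ initialIdeal J := by
  obtain ⟨f, hf, hd, hfS, hlt⟩ := hS
  refine Ideal.subset_span ⟨f, hf, S, ⟨hfS, fun T hT hTS => ?_⟩, rfl⟩
  rw [revLexLT_iff]
  exact Or.inr ⟨by exact_mod_cast mem_grade_iff.1 hd T hT, hlt T hT hTS⟩

/-- The initial monomials of the homogeneous elements of `J` are closed under nonzero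
multiplication by monomials, because the weight is additive. -/
lemma union_mem_leadSet {J : Ideal (Alg K n)} {S T : Finset (Fin n)} (hST : Disjoint S T)
    (hT : T ∈ leadSet J) : S ∪ T ∈ leadSet J := by
  obtain ⟨f, hf, hd, hfT, hlt⟩ := hT
  have hsupp : ∀ U, (monomialBasis K n).repr (monomialBasis K n S * f) U ≠ 0 →
      ∃ T', Disjoint S T' ∧ S ∪ T' = U ∧ (monomialBasis K n).repr f T' ≠ 0 := by
    intro U hU
    obtain ⟨S', T', hST', rfl, hS', hT'⟩ := exists_of_repr_mul_ne_zero hU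
    rw [Basis.repr_self, Finsupp.single_apply_ne_zero] at hS'
    obtain rfl := hS'.1
    exact ⟨T', hST', rfl, hT'⟩
  refine ⟨monomialBasis K n S * f, J.mul_mem_left _ hf, ?_, ?_, fun U hU hUS => ?_⟩
  · rw [Finset.card_union_of_disjoint hST, Nat.cast_add]
    exact mul_mem_grade (monomialBasis_mem_grade S) hd
  · rw [← (monomialBasis K n).sum_repr f, Finset.mul_sum, map_sum, Finsupp.finsetSum_apply,
      Finset.sum_eq_single T]
    · obtain ⟨c, hc, hmul⟩ := monomialBasis_mul_of_disjoint (K := K) hST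
      rw [mul_smul_comm, hmul, map_smul, map_smul, Basis.repr_self]
      simpa using ⟨hfT, hc⟩
    · intro T' _ hT'
      by_cases hS' : Disjoint S T'
      · obtain ⟨c, hc, hmul⟩ := monomialBasis_mul_of_disjoint (K := K) hS'
        rw [mul_smul_comm, hmul, map_smul, map_smul, Basis.repr_self, Finsupp.smul_apply,
          Finsupp.smul_apply, Finsupp.single_eq_of_ne, smul_zero, smul_zero]
        intro h
        apply hT'
        rw [← Finset.union_sdiff_cancel_left hST, h, Finset.union_sdiff_cancel_left hS']
      · rw [mul_smul_comm, monomialBasis_mul_of_not_disjoint hS']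
        simp
    · simp
  · obtain ⟨T', hST', rfl, hT'⟩ := hsupp U hU
    rw [weight_union _ hST', weight_union _ hST]
    have := hlt T' hT' fun h => hUS (by rw [h])
    omega

/-- For a graded ideal `J`, the initial ideal is spanned over `K` by the initial monomials of the
homogeneous elements of `J`. -/
lemma mem_initialIdeal_iff {J : Ideal (Alg K n)}
    (hJ : J.IsHomogeneous (fun m : ℕ => ⋀[K]^m (Fin n → K))) {x : Alg K n} :
    x ∈ initialIdeal J ↔ x ∈ monomialSpan K (leadSet J) := by
  constructor
  · intro hx
    induction hx using Submodule.span_induction with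
    | mem x hx =>
      obtain ⟨f, hf, S, hS, rfl⟩ := hx
      exact monomialBasis_mem_monomialSpan (hS.mem_leadSet hJ hf)
    | zero => exact zero_mem _
    | add x y _ _ hx hy => exact add_mem hx hy
    | smul a x _ hx =>
      intro U hU
      obtain ⟨S, T, hST, rfl, -, hT⟩ := exists_of_repr_mul_ne_zero hU
      exact union_mem_leadSet hST (hx T hT)
  · intro hx
    exact monomialSpan_le (W := (initialIdeal J).restrictScalars K)
      (fun S hS => monomialBasis_mem_initialIdeal hS) hx

/-- A component of an element of the initial ideal is the leading component of an element
of `J`. -/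
lemma exists_lift_of_mem_initialIdeal {J : Ideal (Alg K n)}
    (hJ : J.IsHomogeneous (fun m : ℕ => ⋀[K]^m (Fin n → K))) {x : Alg K n}
    (hx : x ∈ initialIdeal J) {m : ℤ} (hm : x ∈ grade K n m) (l : ℤ) :
    ∃ y ∈ J, y ∈ grade K n m ∧
      restr {S | weight revWeight S = l} y = restr {S | weight revWeight S = l} x ∧
      ∀ l', l < l' → restr {S | weight revWeight S = l'} y = 0 := by
  rw [mem_initialIdeal_iff hJ] at hx
  by_cases h : ∃ S, weight revWeight S = l ∧ (monomialBasis K n).repr x S ≠ 0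
  · obtain ⟨S, rfl, hS⟩ := h
    obtain ⟨f, hf, hd, hfS, hlt⟩ := hx S hS
    rw [mem_grade_iff.1 hm S hS] at hd
    refine ⟨((monomialBasis K n).repr x S / (monomialBasis K n).repr f S) • f,
      (J.restrictScalars K).smul_mem _ hf, Submodule.smul_mem _ _ hd, ext_repr fun T => ?_,
      fun l' hl' => restr_eq_zero (q := {T | weight revWeight T ≤ weight revWeight S}) ?_ ?_⟩
    · by_cases hT : weight revWeight T = weight revWeight S
      · obtain rfl := weight_revWeight_injective hT
        rw [repr_restr_of_mem (by exact hT), repr_restr_of_mem (by exact hT), map_smul,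
          Finsupp.smul_apply, smul_eq_mul, div_mul_cancel₀ _ hfS]
      · rw [repr_restr_of_notMem (by exact hT), repr_restr_of_notMem (by exact hT)]
    · refine Set.disjoint_left.2 fun T hT hT' => ?_
      rw [Set.mem_ofPred_eq] at hT hT'
      omega
    · refine Submodule.smul_mem _ _ fun T hT => ?_
      by_cases hTS : T = S
      · exact (congrArg (weight revWeight) hTS).le
      · exact (hlt T hT hTS).le
  · push Not at h
    refine ⟨0, zero_mem _, zero_mem _, ?_, fun _ _ => map_zero _⟩
    rw [map_zero]
    exact (restr_eq_zero (q := {S | weight revWeight S ≠ l})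
      (Set.disjoint_left.2 fun S hS hS' => hS' hS) fun S hS hS' => hS (h S hS')).symm

/-- An element of `J` is determined by its coordinates at the initial monomials of `J`. -/
lemma eq_zero_of_restr_leadSet_eq_zero {J : Ideal (Alg K n)}
    (hJ : J.IsHomogeneous (fun m : ℕ => ⋀[K]^m (Fin n → K))) {x : Alg K n} (hx : x ∈ J)
    (h : restr (leadSet J) x = 0) : x = 0 := by
  by_contra hne
  obtain ⟨S, hS⟩ := exists_isInitial hne
  apply hS.1
  rw [← repr_restr_of_mem (hS.mem_leadSet hJ hx), h, map_zero, Finsupp.zero_apply]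

/-! ### A finite resolution that is homogeneous for degree and weight -/

section FineResolution

variable {G H : Type} [AddCommGroup G] [AddCommGroup H] {ι κ : Type u}

/-- The component of weight `g` of the free module with basis elements of weights `deg a`. -/
def freeWeight (v : Fin n → G) (deg : ι → G) (g : G) : Submodule K (ι →₀ Alg K n) where
  carrier := {x | ∀ a, x a ∈ weightComp K v (g - deg a)}
  add_mem' hx hy a := add_mem (hx a) (hy a)
  zero_mem' _ := zero_mem _
  smul_mem' c _ hx a := Submodule.smul_mem _ c (hx a)

lemma freeGrade_eq_freeWeight (deg : ι → ℤ) (k : ℤ) :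
    (freeGrade deg k : Submodule K (ι →₀ Alg K n)) = freeWeight (fun _ => (1 : ℤ)) deg k := by
  ext x
  exact forall_congr' fun a => by rw [grade_eq_weightComp]

lemma smul_mem_freeWeight {v : Fin n → G} {deg : ι → G} {g h : G} {e : Alg K n}
    {x : ι →₀ Alg K n} (he : e ∈ weightComp K v g) (hx : x ∈ freeWeight v deg h) :
    e • x ∈ freeWeight v deg (g + h) := by
  intro a
  have := mul_mem_weightComp he (hx a)
  rwa [← add_sub_assoc] at this

lemma freeWeight_independent {v : Fin n → G} {deg : ι → G} (s : Finset G)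
    (y : G → ι →₀ Alg K n) (hy : ∀ g, y g ∈ freeWeight v deg g) (h : ∑ g ∈ s, y g = 0)
    {g : G} (hg : g ∈ s) : y g = 0 := by
  ext1 a
  refine ext_repr fun S => ?_
  rw [Finsupp.zero_apply, map_zero, Finsupp.zero_apply]
  by_contra hne
  have h1 : ∑ l ∈ s, (monomialBasis K n).repr (y l a) S = 0 := by
    rw [← Finsupp.finsetSum_apply, ← map_sum, ← Finsupp.finsetSum_apply, h]
    simp
  rw [Finset.sum_eq_single g _ fun h' => absurd hg h'] at h1
  · exact hne h1
  · intro l _ hl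
    by_contra hne'
    have h2 := (hy l a S hne').symm.trans (hy g a S hne)
    exact hl (sub_left_injective h2)

lemma iSup_freeWeight (v : Fin n → G) (deg : ι → G) :
    ⨆ g, (freeWeight v deg g : Submodule K (ι →₀ Alg K n)) = ⊤ := by
  rw [eq_top_iff]
  rintro x -
  induction x using Finsupp.induction_linear with
  | zero => exact zero_mem _
  | add x y hx hy => exact add_mem hx hy
  | single a e =>
    rw [← (monomialBasis K n).sum_repr e, Finsupp.single_finsetSum]
    refine Submodule.sum_mem _ fun S _ => ?_
    refine Submodule.mem_iSup_of_mem (deg a + weight v S) fun b => ?_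
    by_cases hb : a = b
    · subst hb
      rw [Finsupp.single_eq_same, add_sub_cancel_left]
      exact Submodule.smul_mem _ _ (monomialBasis_mem_monomialSpan rfl)
    · rw [Finsupp.single_eq_of_ne' hb]
      exact zero_mem _

/-- Homogeneity of degree `0` of a map of free modules, expressed by its matrix entries. -/
def IsHomogeneousMap (v : Fin n → G) (deg : ι → G) (deg' : κ → G)
    (d : (ι →₀ Alg K n) →ₗ[Alg K n] (κ →₀ Alg K n)) : Prop :=
  ∀ a b, d (Finsupp.single a 1) b ∈ weightComp K v (deg a - deg' b)

lemma map_eq_sum {M : Type*} [AddCommMonoid M] [Module (Alg K n) M]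
    (d : (ι →₀ Alg K n) →ₗ[Alg K n] M) (x : ι →₀ Alg K n) :
    d x = ∑ a ∈ x.support, x a • d (Finsupp.single a 1) := by
  conv_lhs => rw [← Finsupp.sum_single x]
  rw [Finsupp.sum, map_sum]
  refine Finset.sum_congr rfl fun a _ => ?_
  rw [← map_smul, Finsupp.smul_single, smul_eq_mul, mul_one]

lemma IsHomogeneousMap.map_mem {v : Fin n → G} {deg : ι → G} {deg' : κ → G}
    {d : (ι →₀ Alg K n) →ₗ[Alg K n] (κ →₀ Alg K n)} (hd : IsHomogeneousMap v deg deg' d)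
    {g : G} {x : ι →₀ Alg K n} (hx : x ∈ freeWeight v deg g) : d x ∈ freeWeight v deg' g := by
  rw [map_eq_sum]
  refine Submodule.sum_mem _ fun a _ => ?_
  have h1 : d (Finsupp.single a 1) ∈ freeWeight v deg' (deg a) := fun b => hd a b
  have := smul_mem_freeWeight (hx a) h1
  rwa [sub_add_cancel] at this

lemma IsHomogeneousMap.map (f : G →+ H) {v : Fin n → G} {deg : ι → G} {deg' : κ → G}
    {d : (ι →₀ Alg K n) →ₗ[Alg K n] (κ →₀ Alg K n)} (hd : IsHomogeneousMap v deg deg' d) :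
    IsHomogeneousMap (fun i => f (v i)) (fun a => f (deg a)) (fun b => f (deg' b)) d := by
  intro a b
  rw [← map_sub]
  exact weightComp_le_map f v _ (hd a b)

/-- A submodule of a free module is homogeneous for the weights if it is generated by homogeneous
elements. -/
def IsWeightedSub (v : Fin n → G) (deg : ι → G) (Z : Submodule (Alg K n) (ι →₀ Alg K n)) :
    Prop :=
  Z ≤ Submodule.span (Alg K n) {x | x ∈ Z ∧ ∃ g, x ∈ freeWeight (K := K) v deg g}

lemma isWeightedSub_ker {v : Fin n → G} {deg : ι → G} {deg' : κ → G}
    {d : (ι →₀ Alg K n) →ₗ[Alg K n] (κ →₀ Alg K n)} (hd : IsHomogeneousMap v deg deg' d) :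
    IsWeightedSub v deg (LinearMap.ker d) := by
  intro x hx
  have hx' : x ∈ ⨆ g, (freeWeight v deg g : Submodule K (ι →₀ Alg K n)) := by
    rw [iSup_freeWeight]; trivial
  rw [Submodule.mem_iSup_iff_exists_finsupp] at hx'
  obtain ⟨y, hy, rfl⟩ := hx'
  rw [LinearMap.mem_ker, Finsupp.sum, map_sum] at hx
  refine Submodule.sum_mem _ fun g hg => Submodule.subset_span ⟨?_, g, hy g⟩
  exact freeWeight_independent y.support (fun g => d (y g)) (fun g => hd.map_mem (hy g)) hx hg

variable (K) in
/-- A homogeneous submodule of a finite free module, for weights `v` of the variables. -/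
structure FineStage (v : Fin n → G) where
  /-- index set of the basis of the free module -/
  ι : Type u
  finite : Finite ι
  /-- weights of the basis elements -/
  deg : ι → G
  /-- the submodule -/
  Z : Submodule (Alg K n) (ι →₀ Alg K n)
  weighted : IsWeightedSub v deg Z

instance : Module.Finite K (Alg K n) := Module.Finite.of_basis (monomialBasis K n)

instance : IsNoetherianRing (Alg K n) := IsNoetherianRing.of_finite K _

/-- A homogeneous submodule is the image of a homogeneous map from a finite free module. -/
lemma FineStage.exists_next {v : Fin n → G} (s : FineStage K v) :
    ∃ (t : FineStage K v) (d : (t.ι →₀ Alg K n) →ₗ[Alg K n] (s.ι →₀ Alg K n)),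
      IsHomogeneousMap v t.deg s.deg d ∧ LinearMap.range d = s.Z ∧ t.Z = LinearMap.ker d := by
  have := s.finite
  have hspan : Submodule.span (Alg K n) {x | x ∈ s.Z ∧ ∃ g, x ∈ freeWeight (K := K) v s.deg g}
      = s.Z := le_antisymm (Submodule.span_le.2 fun x hx => hx.1) s.weighted
  obtain ⟨t, ht, hts⟩ := Submodule.fg_span_iff_fg_span_finset_subset _ |>.1
    (IsNoetherian.noetherian (Submodule.span (Alg K n)
      {x | x ∈ s.Z ∧ ∃ g, x ∈ freeWeight (K := K) v s.deg g}))
  choose w hw using fun x : t => (ht x.2).2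
  let d : (t →₀ Alg K n) →ₗ[Alg K n] (s.ι →₀ Alg K n) :=
    Finsupp.linearCombination (Alg K n) fun x : t => (x : s.ι →₀ Alg K n)
  have hd : IsHomogeneousMap v w s.deg d := fun a b => by
    rw [Finsupp.linearCombination_single, one_smul]
    exact hw a b
  refine ⟨⟨t, inferInstance, w, LinearMap.ker d, isWeightedSub_ker hd⟩, d, hd, ?_, rfl⟩
  rw [Finsupp.range_linearCombination, ← hspan, hts]
  exact congrArg _ Subtype.range_coe

lemma monomialBasis_singleton (i : Fin n) :
    monomialBasis K n {i} = ExteriorAlgebra.ι K (Pi.single i (1 : K)) := by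
  rw [monomialBasis, ExteriorAlgebra.basis_apply_ofCard (n := 1) _ (Finset.card_singleton i),
    ExteriorAlgebra.ιMulti_family, ExteriorAlgebra.ιMulti_apply]
  simp [Set.powersetCard.ofFinEmbEquiv_symm_apply]

/-- The kernel of the augmentation `E → E/𝔪`, as a homogeneous submodule. -/
def FineStage.init (v : Fin n → G) : FineStage K v where
  ι := PUnit
  finite := inferInstance
  deg _ := 0
  Z := LinearMap.ker augmentation
  weighted := by
    intro x hx
    have hx' : x PUnit.unit ∈ maxIdeal K n := by
      simpa [augmentation] using hx
    have hxs : x = Finsupp.lsingle (R := Alg K n) PUnit.unit (x PUnit.unit) := by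
      ext
      simp
    rw [hxs, ← Submodule.mem_comap]
    refine Submodule.span_le.2 ?_ hx'
    rintro _ ⟨i, rfl⟩
    refine Submodule.subset_span ⟨?_, v i, fun a => ?_⟩
    · simp only [augmentation, LinearMap.mem_ker, LinearMap.comp_apply, Finsupp.lapply_apply,
        Finsupp.lsingle_apply, Finsupp.single_eq_same, Submodule.mkQ_apply,
        Submodule.Quotient.mk_eq_zero]
      exact Ideal.subset_span ⟨i, rfl⟩
    · rw [Finsupp.lsingle_apply, Finsupp.single_eq_same]
      beta_reduce
      rw [← monomialBasis_singleton]
      refine monomialBasis_mem_monomialSpan ?_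
      simp [weight]

/-- The kernels in a resolution by finite free modules with homogeneous differentials. -/
def fineStage (v : Fin n → G) : ℕ → FineStage K v
  | 0 => FineStage.init v
  | i + 1 => (fineStage v i).exists_next.choose

/-- For any integral weights of the variables, the residue field has a graded resolution by free
modules of finite rank whose differentials are also homogeneous for the weights. -/
theorem exists_weighted_resolution (v : Fin n → ℤ) :
    ∃ (Q : GradedFreeResolution K n) (w : ∀ i, Q.ι i → ℤ), (∀ i, Finite (Q.ι i)) ∧
      ∀ i, IsHomogeneousMap v (w (i + 1)) (w i) (Q.d i) := by
  -- The first component of the weight records the degree.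
  let v' : Fin n → ℤ × ℤ := fun i => (1, v i)
  let s : ℕ → FineStage K v' := fineStage v'
  let d : ∀ i, ((s (i + 1)).ι →₀ Alg K n) →ₗ[Alg K n] ((s i).ι →₀ Alg K n) :=
    fun i => (s i).exists_next.choose_spec.choose
  have hd : ∀ i, IsHomogeneousMap v' (s (i + 1)).deg (s i).deg (d i) ∧
      LinearMap.range (d i) = (s i).Z ∧ (s (i + 1)).Z = LinearMap.ker (d i) :=
    fun i => (s i).exists_next.choose_spec.choose_spec
  refine ⟨{
    ι := fun i => (s i).ι
    deg := fun i a => ((s i).deg a).1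
    d := d
    ε := augmentation
    d_homogeneous := fun i k x hx => ?_
    ε_homogeneous := fun k x hx => ⟨x PUnit.unit, ?_, rfl⟩
    ε_surjective := augmentation_surjective
    exact_zero := LinearMap.exact_iff.2 (hd 0).2.1.symm
    exact_succ := fun i => LinearMap.exact_iff.2 ((hd i).2.2.symm.trans (hd (i + 1)).2.1.symm) },
    fun i a => ((s i).deg a).2, fun i => (s i).finite,
    fun i => (hd i).1.map (AddMonoidHom.snd ℤ ℤ)⟩
  · rw [freeGrade_eq_freeWeight] at hx ⊢
    exact ((hd i).1.map (AddMonoidHom.fst ℤ ℤ)).map_mem hx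
  · have := hx PUnit.unit
    rwa [show k - ((s 0).deg PUnit.unit).1 = k from sub_zero k] at this

end FineResolution

/-! ### Independence of `Ext` from the graded resolution -/

section Lifting

variable {ι κ : Type u} {M : Type u} [AddCommGroup M] [Module K M] [Module (Alg K n) M]

/-- A homogeneous element of the image of a graded map from a free module has a homogeneous
preimage. -/
lemma exists_mem_freeGrade_map_eq {deg : ι → ℤ} {ℳ : ℤ → Submodule K M}
    (hind : ∀ (s : Finset ℤ) (y : ℤ → M), (∀ k, y k ∈ ℳ k) → ∑ k ∈ s, y k = 0 →
      ∀ k ∈ s, y k = 0)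
    {d : (ι →₀ Alg K n) →ₗ[Alg K n] M} (hd : ∀ k x, x ∈ freeGrade deg k → d x ∈ ℳ k)
    {k : ℤ} {m : M} (hm : m ∈ ℳ k) (hmd : m ∈ LinearMap.range d) :
    ∃ x ∈ freeGrade (K := K) deg k, d x = m := by
  obtain ⟨x, rfl⟩ := hmd
  have hx : x ∈ ⨆ k, (freeGrade deg k : Submodule K (ι →₀ Alg K n)) := by
    rw [iSup_freeGrade]; trivial
  rw [Submodule.mem_iSup_iff_exists_finsupp] at hx
  obtain ⟨y, hy, hyx⟩ := hx
  refine ⟨y k, hy k, ?_⟩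
  have hsum : ∑ l ∈ insert k y.support, y l = x := by
    rw [← hyx, Finsupp.sum]
    refine (Finset.sum_subset (Finset.subset_insert _ _) fun l _ hl => ?_).symm
    rwa [Finsupp.notMem_support_iff] at hl
  have h := hind (insert k y.support) (fun l => d (y l) - if l = k then d x else 0)
    (fun l => sub_mem (hd l _ (hy l)) ?_) ?_ k (Finset.mem_insert_self _ _)
  · simpa [sub_eq_zero] using h
  · split_ifs with h
    · rwa [h]
    · exact zero_mem _
  · rw [Finset.sum_sub_distrib, ← map_sum, hsum, Finset.sum_ite_eq',
      if_pos (Finset.mem_insert_self _ _), sub_self]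

lemma single_mem_freeGrade (deg : ι → ℤ) (a : ι) :
    Finsupp.single a 1 ∈ freeGrade (K := K) (n := n) deg (deg a) := by
  intro b
  by_cases hb : a = b
  · subst hb
    rw [Finsupp.single_eq_same, sub_self]
    exact SetLike.GradedOne.one_mem (A := fun m : ℕ => ⋀[K]^m (Fin n → K))
  · rw [Finsupp.single_eq_of_ne' hb]
    exact zero_mem _

/-- A graded map from a graded free module lifts along a graded map of free modules whose image
contains its image. -/
lemma exists_graded_lift {deg : ι → ℤ} {deg' : κ → ℤ} {ℳ : ℤ → Submodule K M}
    (hind : ∀ (s : Finset ℤ) (y : ℤ → M), (∀ k, y k ∈ ℳ k) → ∑ k ∈ s, y k = 0 →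
      ∀ k ∈ s, y k = 0)
    {d : (ι →₀ Alg K n) →ₗ[Alg K n] M} (hd : ∀ k x, x ∈ freeGrade deg k → d x ∈ ℳ k)
    {φ : (κ →₀ Alg K n) →ₗ[Alg K n] M} (hφ : ∀ k x, x ∈ freeGrade deg' k → φ x ∈ ℳ k)
    (h : ∀ x, φ x ∈ LinearMap.range d) :
    ∃ ψ : (κ →₀ Alg K n) →ₗ[Alg K n] (ι →₀ Alg K n),
      (∀ k x, x ∈ freeGrade deg' k → ψ x ∈ freeGrade deg k) ∧ ∀ x, d (ψ x) = φ x := by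
  choose y hy hdy using fun a : κ =>
    exists_mem_freeGrade_map_eq hind hd (hφ _ _ (single_mem_freeGrade deg' a)) (h (Finsupp.single a 1))
  refine ⟨Finsupp.linearCombination (Alg K n) y, fun k x hx => ?_, fun x => ?_⟩
  · rw [Finsupp.linearCombination_apply, Finsupp.sum]
    refine Submodule.sum_mem _ fun a _ => ?_
    have := smul_mem_freeGrade deg (hx a) (hy a)
    rwa [sub_add_cancel] at this
  · refine LinearMap.congr_fun (f := d ∘ₗ Finsupp.linearCombination (Alg K n) y) ?_ x
    refine Finsupp.lhom_ext' fun a => LinearMap.ext_ring ?_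
    simp [hdy]

end Lifting

lemma grade_le_maxIdeal {k : ℤ} (hk : k ≠ 0) {x : Alg K n} (hx : x ∈ grade K n k) :
    x ∈ maxIdeal K n := by
  rw [grade_eq_weightComp] at hx
  refine monomialSpan_le (W := (maxIdeal K n).restrictScalars K) (fun S hS => ?_) hx
  obtain ⟨i, hi⟩ : S.Nonempty := by
    rw [Finset.nonempty_iff_ne_empty]
    rintro rfl
    exact hk (by simpa [weight] using hS.symm)
  obtain ⟨c, hc, hmul⟩ := monomialBasis_mul_of_disjoint (K := K)
    (Finset.disjoint_singleton_right.2 (Finset.notMem_erase i S))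
  rw [Finset.union_comm, ← Finset.insert_eq, Finset.insert_erase hi, monomialBasis_singleton]
    at hmul
  rw [← inv_smul_smul₀ hc (monomialBasis K n S), ← hmul]
  refine Submodule.smul_mem _ _ ?_
  exact (maxIdeal K n).mul_mem_left _ (Ideal.subset_span ⟨i, rfl⟩)

/-- Homogeneous elements of distinct degrees in `E/𝔪` are independent, since `E/𝔪` lives in
degree `0`. -/
lemma quotGrade_maxIdeal_independent (s : Finset ℤ) (y : ℤ → Alg K n ⧸ maxIdeal K n)
    (hy : ∀ k, y k ∈ quotGrade (maxIdeal K n) k) (h : ∑ k ∈ s, y k = 0) :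
    ∀ k ∈ s, y k = 0 := by
  have h0 : ∀ k, k ≠ 0 → y k = 0 := by
    intro k hk
    obtain ⟨x, hx, hxy⟩ := hy k
    rw [← hxy]
    exact (Submodule.Quotient.mk_eq_zero _).2 (grade_le_maxIdeal hk hx)
  intro k hk
  by_cases hk0 : k = 0
  · rwa [Finset.sum_eq_single k (fun l _ hl => h0 l fun h' => hl (h'.trans hk0.symm))
      fun h' => absurd hk h'] at h
  · exact h0 k hk0

/-- Dependent choice along a sequence of types, with prescribed first term. -/
lemma exists_dependent_seq {X : ℕ → Type*} (p : ∀ i, X i → Prop)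
    (r : ∀ i, X i → X (i + 1) → Prop) (x₀ : X 0) (h₀ : p 0 x₀)
    (hs : ∀ i x, p i x → ∃ y, p (i + 1) y ∧ r i x y) :
    ∃ f : ∀ i, X i, f 0 = x₀ ∧ (∀ i, p i (f i)) ∧ ∀ i, r i (f i) (f (i + 1)) := by
  choose g hg hr using hs
  let f : ∀ i, {x : X i // p i x} :=
    fun i => Nat.rec ⟨x₀, h₀⟩ (fun i x => ⟨g i x.1 x.2, hg i x.1 x.2⟩) i
  exact ⟨fun i => (f i).1, rfl, fun i => (f i).2, fun i => hr i (f i).1 (f i).2⟩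

namespace GradedFreeResolution

variable (P Q : GradedFreeResolution K n)

lemma d_d (i : ℕ) (x : P.ι (i + 1 + 1) →₀ Alg K n) : P.d i (P.d (i + 1) x) = 0 :=
  (P.exact_succ i).apply_apply_eq_zero x

/-- The identity of `K` lifts to a graded chain map between two resolutions. -/
lemma exists_chainMap :
    ∃ f : ∀ i, (P.ι i →₀ Alg K n) →ₗ[Alg K n] (Q.ι i →₀ Alg K n),
      (∀ i k x, x ∈ freeGrade (P.deg i) k → f i x ∈ freeGrade (Q.deg i) k) ∧
      (∀ x, Q.ε (f 0 x) = P.ε x) ∧ ∀ i x, Q.d i (f (i + 1) x) = f i (P.d i x) := by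
  obtain ⟨f0, hf0, hε⟩ := exists_graded_lift quotGrade_maxIdeal_independent Q.ε_homogeneous
    P.ε_homogeneous fun x => Q.ε_surjective (P.ε x)
  obtain ⟨f, rfl, hp, hr⟩ := exists_dependent_seq
    (X := fun i => (P.ι i →₀ Alg K n) →ₗ[Alg K n] (Q.ι i →₀ Alg K n))
    (fun i f => (∀ k x, x ∈ freeGrade (P.deg i) k → f x ∈ freeGrade (Q.deg i) k) ∧
      ∀ x, f (P.d i x) ∈ LinearMap.range (Q.d i))
    (fun i f f' => ∀ x, Q.d i (f' x) = f (P.d i x)) f0 ⟨hf0, fun x => by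
      rw [← LinearMap.exact_iff.1 Q.exact_zero, LinearMap.mem_ker, hε]
      exact P.exact_zero.apply_apply_eq_zero x⟩ fun i f hf => by
        obtain ⟨f', hf', hd⟩ := exists_graded_lift (deg := Q.deg (i + 1)) (deg' := P.deg (i + 1))
          (freeGrade_independent (Q.deg i)) (Q.d_homogeneous i) (φ := f ∘ₗ P.d i)
          (fun k x hx => hf.1 k _ (P.d_homogeneous i k x hx)) hf.2
        refine ⟨f', ⟨hf', fun x => ?_⟩, hd⟩
        rw [← LinearMap.exact_iff.1 (Q.exact_succ i), LinearMap.mem_ker, hd, LinearMap.comp_apply,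
          d_d, map_zero]
  exact ⟨f, fun i => (hp i).1, hε, hr⟩

/-- A graded chain endomorphism that induces zero on `K` is null-homotopic, by a graded
homotopy. -/
lemma exists_homotopy (h : ∀ i, (P.ι i →₀ Alg K n) →ₗ[Alg K n] (P.ι i →₀ Alg K n))
    (hh : ∀ i k x, x ∈ freeGrade (P.deg i) k → h i x ∈ freeGrade (P.deg i) k)
    (hε : ∀ x, P.ε (h 0 x) = 0) (hd : ∀ i x, P.d i (h (i + 1) x) = h i (P.d i x)) :
    ∃ s : ∀ i, (P.ι i →₀ Alg K n) →ₗ[Alg K n] (P.ι (i + 1) →₀ Alg K n),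
      (∀ i k x, x ∈ freeGrade (P.deg i) k → s i x ∈ freeGrade (P.deg (i + 1)) k) ∧
      (∀ x, P.d 0 (s 0 x) = h 0 x) ∧
      ∀ i x, P.d (i + 1) (s (i + 1) x) = h (i + 1) x - s i (P.d i x) := by
  obtain ⟨s0, hs0, hds0⟩ := exists_graded_lift (deg := P.deg 1)
    (freeGrade_independent (P.deg 0)) (P.d_homogeneous 0) (φ := h 0) (hh 0) fun x => by
      rw [← LinearMap.exact_iff.1 P.exact_zero, LinearMap.mem_ker, hε]
  obtain ⟨s, rfl, hp, hr⟩ := exists_dependent_seq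
    (X := fun i => (P.ι i →₀ Alg K n) →ₗ[Alg K n] (P.ι (i + 1) →₀ Alg K n))
    (fun i s => (∀ k x, x ∈ freeGrade (P.deg i) k → s x ∈ freeGrade (P.deg (i + 1)) k) ∧
      ∀ x, P.d i (s (P.d i x)) = h i (P.d i x))
    (fun i s s' => ∀ x, P.d (i + 1) (s' x) = h (i + 1) x - s (P.d i x))
    s0 ⟨hs0, fun x => hds0 _⟩ fun i s hs => by
      obtain ⟨s', hs', hd'⟩ := exists_graded_lift (deg := P.deg (i + 1 + 1))
        (freeGrade_independent (P.deg (i + 1))) (P.d_homogeneous (i + 1))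
        (φ := h (i + 1) - s ∘ₗ P.d i)
        (fun k x hx => sub_mem (hh _ k x hx) (hs.1 k _ (P.d_homogeneous i k x hx))) fun x => by
          rw [← LinearMap.exact_iff.1 (P.exact_succ i), LinearMap.mem_ker, LinearMap.sub_apply,
            map_sub, LinearMap.comp_apply, hs.2, hd, sub_self]
      refine ⟨s', ⟨hs', fun x => ?_⟩, hd'⟩
      rw [hd', LinearMap.sub_apply, LinearMap.comp_apply, d_d, map_zero, sub_zero]
  exact ⟨s, fun i => (hp i).1, hds0, hr⟩

variable {P Q}
variable {M : Type u} [AddCommGroup M] [Module K M] [Module (Alg K n) M]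
  [IsScalarTower K (Alg K n) M] (ℳ : ℤ → Submodule K M)

/-- The map `Hom_E(Qᵢ, M) → Hom_E(Pᵢ, M)` given by composition with `f : Pᵢ → Qᵢ`. -/
def precomp (M : Type u) [AddCommGroup M] [Module K M] [Module (Alg K n) M]
    [IsScalarTower K (Alg K n) M] {ι κ : Type u}
    (f : (ι →₀ Alg K n) →ₗ[Alg K n] (κ →₀ Alg K n)) :
    ((κ →₀ Alg K n) →ₗ[Alg K n] M) →ₗ[K] ((ι →₀ Alg K n) →ₗ[Alg K n] M) where
  toFun φ := φ ∘ₗ f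
  map_add' _ _ := rfl
  map_smul' _ _ := rfl

lemma precomp_mem_cocycles {f : ∀ i, (P.ι i →₀ Alg K n) →ₗ[Alg K n] (Q.ι i →₀ Alg K n)}
    (hf : ∀ i k x, x ∈ freeGrade (P.deg i) k → f i x ∈ freeGrade (Q.deg i) k)
    (hd : ∀ i x, Q.d i (f (i + 1) x) = f i (P.d i x)) {i : ℕ} {j : ℤ}
    {φ : (Q.ι i →₀ Alg K n) →ₗ[Alg K n] M} (hφ : φ ∈ Q.cocycles ℳ i j) :
    precomp M (f i) φ ∈ P.cocycles ℳ i j := by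
  refine ⟨fun k x hx => hφ.1 k _ (hf i k x hx), LinearMap.ext fun x => ?_⟩
  change φ (f i (P.d i x)) = 0
  rw [← hd]
  exact LinearMap.congr_fun hφ.2 (f (i + 1) x)

lemma precomp_mem_coboundaries {f : ∀ i, (P.ι i →₀ Alg K n) →ₗ[Alg K n] (Q.ι i →₀ Alg K n)}
    (hf : ∀ i k x, x ∈ freeGrade (P.deg i) k → f i x ∈ freeGrade (Q.deg i) k)
    (hd : ∀ i x, Q.d i (f (i + 1) x) = f i (P.d i x)) {i : ℕ} {j : ℤ}
    {φ : (Q.ι i →₀ Alg K n) →ₗ[Alg K n] M} (hφ : φ ∈ Q.coboundaries ℳ i j) :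
    precomp M (f i) φ ∈ P.coboundaries ℳ i j := by
  cases i with
  | zero =>
    obtain rfl : φ = 0 := hφ
    exact zero_mem _
  | succ i =>
    obtain ⟨ψ, hψ, rfl⟩ := hφ
    refine ⟨precomp M (f i) ψ, fun k x hx => hψ k _ (hf i k x hx), LinearMap.ext fun x => ?_⟩
    exact congrArg ψ (hd i x).symm

variable (P Q) in
/-- Any two graded resolutions of `K` give the same Bass numbers: the comparison maps induce a
surjection on `Ext`, in either direction. -/
theorem bassNumber_le_of_resolutions (i : ℕ) (j : ℤ) :
    P.bassNumber ℳ i j ≤ Q.bassNumber ℳ i j := by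
  obtain ⟨f, hf, hfε, hfd⟩ := exists_chainMap P Q
  obtain ⟨g, hg, hgε, hgd⟩ := exists_chainMap Q P
  obtain ⟨s, hs, hs0, hsd⟩ := P.exists_homotopy (fun i => g i ∘ₗ f i - LinearMap.id)
    (fun i k x hx => sub_mem (hg i k _ (hf i k x hx)) hx)
    (fun x => by simp [hgε, hfε]) (fun i x => by simp [hgd, hfd])
  let F : Q.cocycles ℳ i j →ₗ[K] P.cocycles ℳ i j :=
    ((precomp M (f i)).comp (Q.cocycles ℳ i j).subtype).codRestrict _
      fun φ => precomp_mem_cocycles ℳ hf hfd φ.2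
  have hF : (Q.coboundaries ℳ i j).submoduleOf (Q.cocycles ℳ i j) ≤
      ((P.coboundaries ℳ i j).submoduleOf (P.cocycles ℳ i j)).comap F :=
    fun φ hφ => precomp_mem_coboundaries ℳ hf hfd hφ
  refine LinearMap.rank_le_of_surjective (Submodule.mapQ _ _ F hF) fun y => ?_
  obtain ⟨φ, rfl⟩ := Submodule.mkQ_surjective _ y
  let ψ : Q.cocycles ℳ i j := ⟨precomp M (g i) φ.1, precomp_mem_cocycles ℳ hg hgd φ.2⟩
  refine ⟨Submodule.mkQ _ ψ, ?_⟩
  rw [Submodule.mkQ_apply, Submodule.mapQ_apply, Submodule.mkQ_apply, Submodule.Quotient.eq]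
  change φ.1 ∘ₗ g i ∘ₗ f i - φ.1 ∈ P.coboundaries ℳ i j
  have hφ : ∀ x, φ.1 (P.d i x) = 0 := LinearMap.congr_fun φ.2.2
  cases i with
  | zero =>
    refine LinearMap.ext fun x => ?_
    have := congrArg φ.1 (hs0 x)
    rw [hφ, LinearMap.sub_apply, map_sub] at this
    exact this.symm
  | succ i =>
    -- On cocycles the term of the homotopy that ends in the differential vanishes.
    refine ⟨φ.1 ∘ₗ s i, fun k x hx => φ.2.1 k _ (hs i k x hx),
      LinearMap.ext fun x => ?_⟩
    have := congrArg φ.1 (hsd i x)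
    rw [hφ, map_sub, LinearMap.sub_apply, map_sub] at this
    exact (sub_eq_zero.1 this.symm).symm

end GradedFreeResolution

/-! ### Dimension counts -/

section LinearAlgebra

variable {V X : Type*} [AddCommGroup V] [Module K V] [AddCommGroup X] [Module K X]

lemma finrank_map_add_finrank_inf_ker [Module.Finite K V] (q : V →ₗ[K] X) (A : Submodule K V) :
    finrank K (A.map q) + finrank K (A ⊓ LinearMap.ker q : Submodule K V) = finrank K A := by
  rw [← (q.domRestrict A).finrank_range_add_finrank_ker, LinearMap.range_domRestrict,
    LinearMap.ker_domRestrict, ← Submodule.map_comap_subtype,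
    Submodule.finrank_map_subtype_eq]

lemma finrank_map_add_finrank_of_le [Module.Finite K V] (q : V →ₗ[K] X) {A B : Submodule K V}
    (h : A ≤ B) :
    finrank K (A.map q) + finrank K (B ⊓ LinearMap.ker q : Submodule K V) =
      finrank K (A ⊔ B ⊓ LinearMap.ker q : Submodule K V) := by
  have h1 : (A ⊔ B ⊓ LinearMap.ker q).map q = A.map q := by
    rw [Submodule.map_sup, LinearMap.le_ker_iff_map.1 inf_le_right, sup_bot_eq]
  have h2 : (A ⊔ B ⊓ LinearMap.ker q) ⊓ LinearMap.ker q = B ⊓ LinearMap.ker q :=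
    le_antisymm (inf_le_inf_right _ (sup_le h inf_le_left)) (le_inf le_sup_right inf_le_right)
  rw [← finrank_map_add_finrank_inf_ker q (A ⊔ B ⊓ LinearMap.ker q), h1, h2]

/-- Let `π l`, `l ∈ ℤ`, be the component maps of a finite grading. If every component of an
element of `U'` is the leading component of an element of `U`, then `dim U' ≤ dim U`. -/
lemma finrank_le_of_exists_leading [Module.Finite K V] (π : ℤ → V →ₗ[K] V) (T : Finset ℤ)
    (hT : ∀ l, l ∉ T → π l = 0) (hπ : ∀ v, (∀ l, π l v = 0) → v = 0) {U U' : Submodule K V}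
    (h : ∀ v ∈ U', ∀ l, ∃ u ∈ U, π l u = π l v ∧ ∀ l', l < l' → π l' u = 0) :
    finrank K U' ≤ finrank K U := by
  have hs : ∀ l, ∃ s : U'.map (π l) →ₗ[K] U, ∀ m, π l (s m) = m ∧ ∀ l', l < l' →
      π l' (s m) = 0 := by
    intro l
    have hm : ∀ m : U'.map (π l), ∃ u : U, π l u = m ∧ ∀ l', l < l' → π l' u = 0 := by
      rintro ⟨_, v, hv, rfl⟩
      obtain ⟨u, hu, hul⟩ := h v hv l
      exact ⟨⟨u, hu⟩, hul⟩
    choose f hf hf' using hm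
    let b := Basis.ofVectorSpace K (U'.map (π l))
    refine ⟨b.constr K fun k => f (b k), fun m => ⟨?_, fun l' hl' => ?_⟩⟩
    · refine LinearMap.congr_fun (f := π l ∘ₗ U.subtype ∘ₗ b.constr K fun k => f (b k))
        (g := (U'.map (π l)).subtype) (b.ext fun k => ?_) m
      rw [LinearMap.comp_apply, LinearMap.comp_apply, Basis.constr_basis]
      exact hf (b k)
    · refine LinearMap.congr_fun (f := π l' ∘ₗ U.subtype ∘ₗ b.constr K fun k => f (b k))
        (g := 0) (b.ext fun k => ?_) m
      rw [LinearMap.comp_apply, LinearMap.comp_apply, Basis.constr_basis]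
      exact hf' (b k) l' hl'
  choose s hs hs' using hs
  -- The sum of the lifts of the components of `v` has the same leading component as `v`.
  let Φ : U' →ₗ[K] U := ∑ l ∈ T, s l ∘ₗ (π l).submoduleMap U'
  refine LinearMap.finrank_le_finrank_of_injective (f := Φ) ?_
  rw [← LinearMap.ker_eq_bot, LinearMap.ker_eq_bot']
  intro v hv
  by_contra hne
  classical
  have hne' : ({l ∈ T | π l v ≠ 0} : Finset ℤ).Nonempty := by
    by_contra hempty
    rw [Finset.not_nonempty_iff_eq_empty, Finset.filter_eq_empty_iff] at hempty
    refine hne (Subtype.ext (hπ _ fun l => ?_))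
    by_cases hl : l ∈ T
    · exact not_not.1 (hempty hl)
    · rw [hT l hl, LinearMap.zero_apply]
  obtain ⟨l, hl, hmax⟩ := Finset.exists_max_image _ id hne'
  rw [Finset.mem_filter] at hl
  apply hl.2
  have hsum : ∑ l' ∈ T, π l (s l' ((π l').submoduleMap U' v)) = 0 := by
    have := congrArg (fun u : U => π l u) hv
    simpa [Φ] using this
  rw [Finset.sum_eq_single l _ fun h' => absurd hl.1 h', hs] at hsum
  · exact hsum
  · intro l' hl' hne
    rcases lt_or_gt_of_ne hne with hlt | hlt
    · exact hs' l' _ l hlt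
    · have h0 : π l' v = 0 := by
        by_contra h0
        exact absurd (hmax l' (Finset.mem_filter.2 ⟨hl', h0⟩)) (not_le.2 hlt)
      rw [show (π l').submoduleMap U' v = 0 from Subtype.ext h0, map_zero, Submodule.coe_zero,
        map_zero]

end LinearAlgebra

instance (J : Ideal (Alg K n)) : Module.Finite K (Alg K n ⧸ J) :=
  Module.Finite.of_surjective (J.mkQ.restrictScalars K) J.mkQ_surjective

instance {ι : Type u} [Finite ι] {M : Type u} [AddCommGroup M] [Module K M] [Module (Alg K n) M]
    [IsScalarTower K (Alg K n) M] [Module.Finite K M] :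
    Module.Finite K ((ι →₀ Alg K n) →ₗ[Alg K n] M) :=
  Module.Finite.of_injective
    ({ toFun := fun f a => f (Finsupp.single a 1)
       map_add' := fun _ _ => rfl
       map_smul' := fun _ _ => rfl } : ((ι →₀ Alg K n) →ₗ[Alg K n] M) →ₗ[K] (ι → M))
    fun _ _ h => Finsupp.lhom_ext' fun a => LinearMap.ext_ring (congrFun h a)

lemma smul_mem_quotGrade (J : Ideal (Alg K n)) {k l : ℤ} {e : Alg K n} {m : Alg K n ⧸ J}
    (he : e ∈ grade K n k) (hm : m ∈ quotGrade J l) : e • m ∈ quotGrade J (k + l) := by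
  obtain ⟨x, hx, rfl⟩ := hm
  exact ⟨e * x, mul_mem_grade he hx, rfl⟩

/-- Reduction modulo `J` of the maps from a free module to `E`. -/
def homMkQ (ι : Type u) (J : Ideal (Alg K n)) :
    ((ι →₀ Alg K n) →ₗ[Alg K n] Alg K n) →ₗ[K] ((ι →₀ Alg K n) →ₗ[Alg K n] (Alg K n ⧸ J)) where
  toFun f := J.mkQ ∘ₗ f
  map_add' f g := LinearMap.comp_add f g _
  map_smul' c f := by
    ext
    simp

lemma mem_ker_homMkQ {ι : Type u} {J : Ideal (Alg K n)}
    {f : (ι →₀ Alg K n) →ₗ[Alg K n] Alg K n} :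
    f ∈ LinearMap.ker (homMkQ ι J) ↔ ∀ x, f x ∈ J := by
  rw [LinearMap.mem_ker, LinearMap.ext_iff]
  exact forall_congr' fun x => Submodule.Quotient.mk_eq_zero J

lemma mem_ker_homMkQ_iff_single {ι : Type u} {J : Ideal (Alg K n)}
    {f : (ι →₀ Alg K n) →ₗ[Alg K n] Alg K n} :
    f ∈ LinearMap.ker (homMkQ ι J) ↔ ∀ a, f (Finsupp.single a 1) ∈ J := by
  rw [mem_ker_homMkQ]
  refine ⟨fun h a => h _, fun h x => ?_⟩
  rw [map_eq_sum]
  exact Submodule.sum_mem _ fun a _ => J.mul_mem_left _ (h a)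

/-- Coordinate projections applied to the values of a map on the basis elements. -/
def homRestr {ι : Type u} (p : ι → Set (Finset (Fin n))) :
    ((ι →₀ Alg K n) →ₗ[Alg K n] Alg K n) →ₗ[K] ((ι →₀ Alg K n) →ₗ[Alg K n] Alg K n) where
  toFun f := Finsupp.linearCombination (Alg K n) fun a => restr (p a) (f (Finsupp.single a 1))
  map_add' f g := by
    ext a
    simp
  map_smul' c f := by
    ext a
    simp

lemma homRestr_single {ι : Type u} (p : ι → Set (Finset (Fin n)))
    (f : (ι →₀ Alg K n) →ₗ[Alg K n] Alg K n) (a : ι) :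
    homRestr p f (Finsupp.single a 1) = restr (p a) (f (Finsupp.single a 1)) := by
  simp [homRestr]

lemma hom_ext_single {ι : Type u} {M : Type*} [AddCommMonoid M] [Module (Alg K n) M]
    {f g : (ι →₀ Alg K n) →ₗ[Alg K n] M}
    (h : ∀ a, f (Finsupp.single a 1) = g (Finsupp.single a 1)) : f = g :=
  Finsupp.lhom_ext' fun a => LinearMap.ext_ring (h a)

namespace GradedFreeResolution

variable (P : GradedFreeResolution K n)

section

variable {M : Type u} [AddCommGroup M] [Module K M] [Module (Alg K n) M]
  [IsScalarTower K (Alg K n) M] {ℳ : ℤ → Submodule K M}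

lemma mem_homDegree_iff
    (hℳ : ∀ {k l : ℤ} {e : Alg K n} {m : M}, e ∈ grade K n k → m ∈ ℳ l → e • m ∈ ℳ (k + l))
    {i : ℕ} {j : ℤ} {f : (P.ι i →₀ Alg K n) →ₗ[Alg K n] M} :
    f ∈ P.homDegree ℳ i j ↔ ∀ a, f (Finsupp.single a 1) ∈ ℳ (P.deg i a + j) := by
  refine ⟨fun h a => h _ _ (single_mem_freeGrade _ a), fun h k x hx => ?_⟩
  rw [map_eq_sum]
  refine Submodule.sum_mem _ fun a _ => ?_
  have := hℳ (hx a) (h a)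
  rwa [show k - P.deg i a + (P.deg i a + j) = k + j by ring] at this

lemma coboundaries_le_cocycles (i : ℕ) (j : ℤ) : P.coboundaries ℳ i j ≤ P.cocycles ℳ i j := by
  cases i with
  | zero => exact bot_le
  | succ i =>
    rintro _ ⟨f, hf, rfl⟩
    refine ⟨fun k x hx => hf k _ (P.d_homogeneous i k x hx), LinearMap.ext fun x => ?_⟩
    change f (P.d i (P.d (i + 1) x)) = 0
    rw [d_d, map_zero]

lemma finrank_ext_add [∀ i, Finite (P.ι i)] [Module.Finite K M] (i : ℕ) (j : ℤ) :
    finrank K (P.ext ℳ i j) + finrank K (P.coboundaries ℳ i j) +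
      finrank K (P.coboundaries ℳ (i + 1) j) = finrank K (P.homDegree ℳ i j) := by
  rw [← finrank_map_add_finrank_inf_ker (P.coboundary M i) (P.homDegree ℳ i j), add_comm,
    ← LinearEquiv.finrank_eq (Submodule.submoduleOfEquivOfLe (P.coboundaries_le_cocycles i j)),
    Submodule.finrank_quotient_add_finrank]
  rfl

end

variable (J : Ideal (Alg K n)) (i : ℕ) (j : ℤ)

lemma map_homMkQ_homDegree :
    (P.homDegree (grade K n) i j).map (homMkQ (P.ι i) J) = P.homDegree (quotGrade J) i j := by
  refine le_antisymm ?_ fun g hg => ?_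
  · rintro _ ⟨f, hf, rfl⟩ k x hx
    exact ⟨f x, hf k x hx, rfl⟩
  · rw [mem_homDegree_iff P (smul_mem_quotGrade J)] at hg
    choose y hy hyg using hg
    refine ⟨Finsupp.linearCombination (Alg K n) y, ?_, hom_ext_single fun a => ?_⟩
    · rw [SetLike.mem_coe, mem_homDegree_iff P mul_mem_grade]
      intro a
      simpa using hy a
    · rw [← hyg]
      simp [homMkQ]

lemma map_homMkQ_coboundaries :
    (P.coboundaries (grade K n) i j).map (homMkQ (P.ι i) J) =
      P.coboundaries (quotGrade J) i j := by
  cases i with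
  | zero => exact Submodule.map_bot _
  | succ i =>
    rw [coboundaries, coboundaries, ← map_homMkQ_homDegree, ← Submodule.map_comp,
      ← Submodule.map_comp]
    rfl

/-- The maps `Fᵢ → E` of degree `j` with values in `J`. -/
def homIdeal : Submodule K ((P.ι i →₀ Alg K n) →ₗ[Alg K n] Alg K n) :=
  P.homDegree (grade K n) i j ⊓ LinearMap.ker (homMkQ (P.ι i) J)

/-- The Bass numbers of `E/J`, expressed through subspaces of `Hom_E(F, E)`. -/
lemma finrank_ext_quotGrade_add [∀ i, Finite (P.ι i)] :
    finrank K (P.ext (quotGrade J) i j) +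
        finrank K (P.coboundaries (grade K n) i j ⊔ P.homIdeal J i j :
          Submodule K ((P.ι i →₀ Alg K n) →ₗ[Alg K n] Alg K n)) +
        finrank K (P.coboundaries (grade K n) (i + 1) j ⊔ P.homIdeal J (i + 1) j :
          Submodule K ((P.ι (i + 1) →₀ Alg K n) →ₗ[Alg K n] Alg K n)) =
      finrank K (P.homDegree (grade K n) i j) + finrank K (P.homIdeal J (i + 1) j) := by
  have h1 := finrank_map_add_finrank_of_le (homMkQ (P.ι i) J)
    ((P.coboundaries_le_cocycles (ℳ := grade K n) i j).trans inf_le_left)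
  have h2 := finrank_map_add_finrank_of_le (homMkQ (P.ι (i + 1)) J)
    ((P.coboundaries_le_cocycles (ℳ := grade K n) (i + 1) j).trans inf_le_left)
  have h3 := finrank_map_add_finrank_inf_ker (homMkQ (P.ι i) J) (P.homDegree (grade K n) i j)
  have h4 := P.finrank_ext_add (ℳ := quotGrade J) i j
  rw [map_homMkQ_coboundaries] at h1 h2
  rw [map_homMkQ_homDegree] at h3
  rw [← homIdeal] at h1 h2 h3
  omega

variable {J}

/-- Macaulay's comparison, in the form needed here: projecting to the coordinates at the initial
monomials of `J` is injective on `J`. -/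
lemma finrank_homIdeal_le (hJ : J.IsHomogeneous (fun m : ℕ => ⋀[K]^m (Fin n → K)))
    [Finite (P.ι i)] :
    finrank K (P.homIdeal J i j) ≤ finrank K (P.homIdeal (initialIdeal J) i j) := by
  have hmaps : ∀ f ∈ P.homIdeal J i j,
      homRestr (fun _ => leadSet J) f ∈ P.homIdeal (initialIdeal J) i j := by
    intro f hf
    refine ⟨?_, mem_ker_homMkQ_iff_single.2 fun a => ?_⟩
    · rw [SetLike.mem_coe, mem_homDegree_iff P mul_mem_grade]
      intro a
      rw [homRestr_single, grade_eq_weightComp]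
      refine restr_mem_monomialSpan _ ?_
      have := (mem_homDegree_iff P mul_mem_grade).1 hf.1 a
      rwa [grade_eq_weightComp] at this
    · rw [homRestr_single, mem_initialIdeal_iff hJ]
      exact restr_mem _ _
  refine LinearMap.finrank_le_finrank_of_injective
    (f := (homRestr fun _ => leadSet J).restrict hmaps) ?_
  refine (injective_iff_map_eq_zero _).2 ?_
  rintro ⟨f, hf⟩ h
  refine Subtype.ext (hom_ext_single fun a => ?_)
  refine eq_zero_of_restr_leadSet_eq_zero hJ (mem_ker_homMkQ.1 hf.2 _) ?_
  rw [← homRestr_single (fun _ => leadSet J)]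
  exact LinearMap.congr_fun (congrArg Subtype.val h) _

/-! ### Degeneration -/

/-- The component of weight `l` of the maps `F → E`, where the basis elements of `F` have
weights `w` and `E` carries the reverse lexicographic weight. -/
def homWeightProj {ι : Type u} (w : ι → ℤ) (l : ℤ) :
    ((ι →₀ Alg K n) →ₗ[Alg K n] Alg K n) →ₗ[K] ((ι →₀ Alg K n) →ₗ[Alg K n] Alg K n) :=
  homRestr fun a => {S | weight revWeight S = w a + l}

lemma homWeightProj_self {ι : Type u} (w : ι → ℤ) (l : ℤ)
    (f : (ι →₀ Alg K n) →ₗ[Alg K n] Alg K n) :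
    homWeightProj w l (homWeightProj w l f) = homWeightProj w l f := by
  refine hom_ext_single fun a => ?_
  rw [homWeightProj, homRestr_single, homRestr_single, restr_of_mem (restr_mem _ _)]

lemma homWeightProj_of_ne {ι : Type u} (w : ι → ℤ) {l l' : ℤ} (h : l ≠ l')
    (f : (ι →₀ Alg K n) →ₗ[Alg K n] Alg K n) :
    homWeightProj w l (homWeightProj w l' f) = 0 := by
  refine hom_ext_single fun a => ?_
  rw [homWeightProj, homWeightProj, homRestr_single, homRestr_single, LinearMap.zero_apply]
  refine restr_eq_zero (Set.disjoint_left.2 fun S hS hS' => h ?_) (restr_mem _ _)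
  rw [Set.mem_ofPred_eq] at hS hS'
  omega

lemma homWeightProj_mem_homDegree (w : P.ι i → ℤ) (l : ℤ)
    {f : (P.ι i →₀ Alg K n) →ₗ[Alg K n] Alg K n} (hf : f ∈ P.homDegree (grade K n) i j) :
    homWeightProj w l f ∈ P.homDegree (grade K n) i j := by
  rw [mem_homDegree_iff P mul_mem_grade] at hf ⊢
  intro a
  rw [homWeightProj, homRestr_single, grade_eq_weightComp]
  refine restr_mem_monomialSpan _ ?_
  have := hf a
  rwa [grade_eq_weightComp] at this

/-- Composition with a differential that is homogeneous for the weights preserves weights. -/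
lemma homWeightProj_comp {ι κ : Type u} {w : ι → ℤ} {w' : κ → ℤ}
    {d : (κ →₀ Alg K n) →ₗ[Alg K n] (ι →₀ Alg K n)} (hd : IsHomogeneousMap revWeight w' w d)
    (l : ℤ) (f : (ι →₀ Alg K n) →ₗ[Alg K n] Alg K n) :
    homWeightProj w' l (f ∘ₗ d) = homWeightProj w l f ∘ₗ d := by
  refine hom_ext_single fun b => ?_
  rw [homWeightProj, homRestr_single, LinearMap.comp_apply, LinearMap.comp_apply, map_eq_sum f,
    map_eq_sum (homWeightProj w l f), map_sum]
  refine Finset.sum_congr rfl fun a _ => ?_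
  rw [homWeightProj, homRestr_single, smul_eq_mul, smul_eq_mul,
    ← restr_mul_of_mem (hd b a), show w' b - w a + (w a + l) = w' b + l by ring]

lemma homWeightProj_mem_coboundaries {w : ∀ i, P.ι i → ℤ}
    (hw : ∀ i, IsHomogeneousMap revWeight (w (i + 1)) (w i) (P.d i)) (l : ℤ)
    {f : (P.ι i →₀ Alg K n) →ₗ[Alg K n] Alg K n} (hf : f ∈ P.coboundaries (grade K n) i j) :
    homWeightProj (w i) l f ∈ P.coboundaries (grade K n) i j := by
  cases i with
  | zero =>
    obtain rfl : f = 0 := hf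
    rw [map_zero]
    exact zero_mem _
  | succ i =>
    obtain ⟨g, hg, rfl⟩ := hf
    exact ⟨homWeightProj (w i) l g, P.homWeightProj_mem_homDegree i j (w i) l hg,
      (homWeightProj_comp (hw i) l g).symm⟩

/-- Passing to the initial ideal can only decrease the dimension of the sum with the
coboundaries: these are homogeneous for the weight, so the leading components of
`coboundaries + Hom(F, J)` contain both summands of `coboundaries + Hom(F, in(J))`. -/
lemma finrank_coboundaries_sup_le (hJ : J.IsHomogeneous (fun m : ℕ => ⋀[K]^m (Fin n → K)))
    [Finite (P.ι i)] {w : ∀ i, P.ι i → ℤ}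
    (hw : ∀ i, IsHomogeneousMap revWeight (w (i + 1)) (w i) (P.d i)) :
    finrank K (P.coboundaries (grade K n) i j ⊔ P.homIdeal (initialIdeal J) i j :
        Submodule K ((P.ι i →₀ Alg K n) →ₗ[Alg K n] Alg K n)) ≤
      finrank K (P.coboundaries (grade K n) i j ⊔ P.homIdeal J i j :
        Submodule K ((P.ι i →₀ Alg K n) →ₗ[Alg K n] Alg K n)) := by
  classical
  have := Fintype.ofFinite (P.ι i)
  refine finrank_le_of_exists_leading (homWeightProj (w i))
    (Finset.univ.image fun q : P.ι i × Finset (Fin n) => weight revWeight q.2 - w i q.1)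
    (fun l hl => ?_) (fun f hf => ?_) fun f hf l => ?_
  · refine LinearMap.ext fun f => hom_ext_single fun a => ?_
    rw [homWeightProj, homRestr_single]
    refine ext_repr fun S => ?_
    rw [repr_restr_of_notMem fun hS => hl ?_]
    · simp
    · rw [Set.mem_ofPred_eq] at hS
      refine Finset.mem_image.2 ⟨(a, S), Finset.mem_univ _, ?_⟩
      dsimp only
      omega
  · refine hom_ext_single fun a => ext_repr fun S => ?_
    have h := LinearMap.congr_fun (hf (weight revWeight S - w i a)) (Finsupp.single a 1)
    rw [homWeightProj, homRestr_single] at h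
    rw [← repr_restr_of_mem (p := {T | weight revWeight T = w i a + (weight revWeight S - w i a)})
      (by rw [Set.mem_ofPred_eq]; ring), h]
  · obtain ⟨u, hu, v, hv, rfl⟩ := Submodule.mem_sup.1 hf
    have hv1 := (mem_homDegree_iff P mul_mem_grade).1 hv.1
    choose y hyJ hyd hyl hyl' using fun a => exists_lift_of_mem_initialIdeal hJ
      (mem_ker_homMkQ.1 hv.2 (Finsupp.single a 1)) (hv1 a) (w i a + l)
    have hy : ∀ a, Finsupp.linearCombination (Alg K n) y (Finsupp.single a 1) = y a := by
      simp
    -- `u` is replaced by its component of weight `l`, and `v` by a map into `J` whose leading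
    -- component is the component of `v` of weight `l`.
    refine ⟨homWeightProj (w i) l u + Finsupp.linearCombination (Alg K n) y,
      Submodule.add_mem_sup (P.homWeightProj_mem_coboundaries i j hw l hu) ⟨?_, ?_⟩, ?_,
      fun l' hl' => ?_⟩
    · rw [SetLike.mem_coe, mem_homDegree_iff P mul_mem_grade]
      intro a
      rw [hy]
      exact hyd a
    · refine mem_ker_homMkQ_iff_single.2 fun a => ?_
      rw [hy]
      exact hyJ a
    · rw [map_add, map_add, homWeightProj_self]
      refine congrArg _ (hom_ext_single fun a => ?_)
      rw [homWeightProj, homRestr_single, homRestr_single, hy, hyl]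
    · rw [map_add, homWeightProj_of_ne _ (ne_of_gt hl'), zero_add]
      refine hom_ext_single fun a => ?_
      rw [homWeightProj, homRestr_single, hy, LinearMap.zero_apply]
      exact hyl' a _ (by omega)

/-- The inequality of Bass numbers, computed from a finite resolution that is homogeneous for the
reverse lexicographic weight. -/
theorem bassNumber_le_initialIdeal (hJ : J.IsHomogeneous (fun m : ℕ => ⋀[K]^m (Fin n → K)))
    [∀ i, Finite (P.ι i)] {w : ∀ i, P.ι i → ℤ}
    (hw : ∀ i, IsHomogeneousMap revWeight (w (i + 1)) (w i) (P.d i)) :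
    P.bassNumber (quotGrade J) i j ≤ P.bassNumber (quotGrade (initialIdeal J)) i j := by
  rw [bassNumber, bassNumber, ← finrank_eq_rank, ← finrank_eq_rank, Nat.cast_le]
  have h1 := P.finrank_ext_quotGrade_add J i j
  have h2 := P.finrank_ext_quotGrade_add (initialIdeal J) i j
  have h3 := P.finrank_homIdeal_le (i + 1) j hJ
  have h4 := P.finrank_coboundaries_sup_le i j hJ hw
  have h5 := P.finrank_coboundaries_sup_le (i + 1) j hJ hw
  omega

end GradedFreeResolution

end ExteriorBass

end

theorem mainTheorem10 {K : Type u} [Field K] {n : ℕ}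
    (J : Ideal (ExteriorBass.Alg K n))
    (hJ : J.IsHomogeneous (fun m : ℕ => ⋀[K]^m (Fin n → K)))
    (P : ExteriorBass.GradedFreeResolution K n) (i : ℕ) (j : ℤ) :
    P.bassNumber (ExteriorBass.quotGrade J) i j ≤
      P.bassNumber (ExteriorBass.quotGrade (ExteriorBass.initialIdeal J)) i j := by
  obtain ⟨Q, w, hfin, hw⟩ := ExteriorBass.exists_weighted_resolution (K := K)
    (ExteriorBass.revWeight : Fin n → ℤ)
  calc P.bassNumber (ExteriorBass.quotGrade J) i j
    _ ≤ Q.bassNumber (ExteriorBass.quotGrade J) i j := P.bassNumber_le_of_resolutions Q _ i j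
    _ ≤ Q.bassNumber (ExteriorBass.quotGrade (ExteriorBass.initialIdeal J)) i j :=
      Q.bassNumber_le_initialIdeal i j hJ hw
    _ ≤ P.bassNumber (ExteriorBass.quotGrade (ExteriorBass.initialIdeal J)) i j :=
      Q.bassNumber_le_of_resolutions P _ i j
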